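/- Let $n,m\ge 1$ and put $n_1=n$, $n_2=m$. For $i=1,2$ let $s_i\in\{0,1,2,\dots\}$, let $A_i$ be a real $n_i\times n_i$ matrix all of whose complex eigenvalues have modulus $>1$, let $A_i^*$ be its transpose and $b_i=|\det A_i|$, and let $B^{(i)}_0\subset\mathbb R^{n_i}$ be an open ellipsoid centred at the origin with $|B^{(i)}_0|=1$ and $B^{(i)}_0\subset rB^{(i)}_0\subset A_iB^{(i)}_0$ for some $r>1$. Functions are complex valued, and $\widehat\varphi(\xi)=\int\varphi(x)e^{-2\pi i x\cdot\xi}\,dx$. Let $\theta^{(i)},\psi^{(i)}\in\mathcal S(\mathbb R^{n_i})$ satisfy (i) $\operatorname{supp}\theta^{(i)}\subset B^{(i)}_0$; $\int x^\gamma\theta^{(i)}(x)\,dx=0$ for all multi-indices $\gamma$ with $|\gamma|\le s_i$; and $\widehat{\theta^{(i)}}\ge C>0$ on some annulus (possibly elliptical), for a constant $C$; (ii) $\operatorname{supp}\widehat{\psi^{(i)}}$ is compact and bounded away from the origin; (iii) $\sum_{j\in\mathbb Z}\widehat{\psi^{(i)}}((A_i^*)^j\xi)\,\widehat{\theta^{(i)}}((A_i^*)^j\xi)=1$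 for all $\xi\in\mathbb R^{n_i}\setminus\{0\}$. Put $\theta(x)=\theta^{(1)}(x_1)\theta^{(2)}(x_2)$ and $\psi(x)=\psi^{(1)}(x_1)\psi^{(2)}(x_2)$ for $x=(x_1,x_2)\in\mathbb R^n\times\mathbb R^m$, and for a function $\varphi$ on $\mathbb R^n\times\mathbb R^m$ and $j_1,j_2\in\mathbb Z$ put $\varphi_{j_1,j_2}(x)=b_1^{-j_1}b_2^{-j_2}\varphi(A_1^{-j_1}x_1,A_2^{-j_2}x_2)$. Then $$f=\sum_{j_1,j_2\in\mathbb Z}f*\psi_{j_1,j_2}*\theta_{j_1,j_2}$$ in each of the following cases. (a) $f\in L^2(\mathbb R^n\times\mathbb R^m)$: all terms lie in $L^2$, and the series converges to $f$ unconditionally in $L^2$. (b) $f\in\mathcal S_\infty(\mathbb R^n\times\mathbb R^m)$, that is, $f\in\mathcal S(\mathbb R^n\times\mathbb R^m)$, $\int f(x_1,x_2)x_1^\gamma\,dx_1=0$ for all $\gamma$ and all $x_2$, and $\int f(x_1,x_2)x_2^\beta\,dx_2=0$ for all $\beta$ and all $x_1$: the series converges to $f$ unconditionally in $\mathcal S$.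 (c) $f\in\mathcal S'(\mathbb R^n\times\mathbb R^m)$ vanishes weakly at infinity, that is, for all $\varphi^{(1)}\in\mathcal S(\mathbb R^n)$ and $\varphi^{(2)}\in\mathcal S(\mathbb R^m)$, with $\varphi(x)=\varphi^{(1)}(x_1)\varphi^{(2)}(x_2)$, one has $f*\varphi_{k_1,k_2}\to0$ in $\mathcal S'$ as $k_1\to\infty$ or $k_2\to\infty$, i.e. as $\max\{k_1,k_2\}\to\infty$ with $(k_1,k_2)\in\mathbb Z^2$: the rectangular partial sums $\sum_{j_1=M_1}^{N_1}\sum_{j_2=M_2}^{N_2}f*\psi_{j_1,j_2}*\theta_{j_1,j_2}$ converge to $f$ in $\mathcal S'$ as $M_1,M_2\to-\infty$ and $N_1,N_2\to\infty$ independently. -/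

import Mathlib

open MeasureTheory Filter Topology FourierTransform SchwartzMap
open scoped Convolution

namespace AnisoCalderon

/-- `ℝⁿ` with its Euclidean structure. -/
abbrev Rn (n : ℕ) := EuclideanSpace ℝ (Fin n)

/-- `ℝⁿ × ℝᵐ` with its Euclidean structure and Lebesgue measure; points are `WithLp.toLp 2 (x₁, x₂)`
and the two components of `x` are `x.fst` and `x.snd`. -/
abbrev RnRm (n m : ℕ) := WithLp 2 (Rn n × Rn m)

/-- An expansive dilation: a real `n × n` matrix all of whose complex eigenvalues have modulus
greater than `1`. -/
structure Dilation (n : ℕ) where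
  mat : Matrix (Fin n) (Fin n) ℝ
  expansive : ∀ μ ∈ spectrum ℂ (mat.map (algebraMap ℝ ℂ)), 1 < ‖μ‖

namespace Dilation

variable {n : ℕ}

theorem isUnit_mat (A : Dilation n) : IsUnit A.mat := by
  have h0 : (0 : ℂ) ∉ spectrum ℂ (A.mat.map (algebraMap ℝ ℂ)) := fun h => by
    have := A.expansive 0 h
    norm_num at this
  rw [spectrum.zero_notMem_iff, Matrix.isUnit_iff_isUnit_det] at h0
  rw [Matrix.isUnit_iff_isUnit_det]
  have hdet : (A.mat.map (algebraMap ℝ ℂ)).det = algebraMap ℝ ℂ A.mat.det :=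
    ((algebraMap ℝ ℂ).map_det A.mat).symm
  rw [hdet, isUnit_iff_ne_zero] at h0
  rw [isUnit_iff_ne_zero]
  intro h
  exact h0 (by rw [h, map_zero])

/-- The number `b = |det A|`. -/
noncomputable def b (A : Dilation n) : ℝ := |A.mat.det|

/-- The map `x ↦ A x`, as a continuous linear automorphism of `ℝⁿ`; its integer powers in the group
of automorphisms are the maps `x ↦ A ^ k x`. -/
noncomputable def equiv (A : Dilation n) : Rn n ≃L[ℝ] Rn n :=
  ContinuousLinearEquiv.ofUnit
    (A.isUnit_mat.unit.map (Matrix.toEuclideanCLM (n := Fin n) (𝕜 := ℝ) : _ →* (Rn n →L[ℝ] Rn n)))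

theorem equiv_apply (A : Dilation n) (x : Rn n) :
    A.equiv x = WithLp.toLp 2 (A.mat.mulVec x.ofLp) := rfl

/-- The transposed dilation `A*`. -/
def transpose (A : Dilation n) : Dilation n where
  mat := A.mat.transpose
  expansive μ hμ := by
    refine A.expansive μ ?_
    rw [spectrum.mem_iff, Matrix.isUnit_iff_isUnit_det] at hμ ⊢
    rw [← Matrix.det_transpose] at hμ
    simpa [Matrix.transpose_sub, Matrix.transpose_map, Matrix.algebraMap_eq_diagonal] using hμ

/-- `Δ` is an admissible unit ball `B₀` for `A`: an open ellipsoid centred at the origin with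
`|Δ| = 1` and `Δ ⊆ r Δ ⊆ A Δ` for some `r > 1`. -/
def IsUnitBall (A : Dilation n) (Δ : Set (Rn n)) : Prop :=
  (∃ L : Rn n ≃L[ℝ] Rn n, Δ = L '' Metric.ball 0 1) ∧ volume Δ = 1 ∧
    ∃ r : ℝ, 1 < r ∧ Δ ⊆ (fun x => r • x) '' Δ ∧ (fun x => r • x) '' Δ ⊆ A.equiv '' Δ

end Dilation

/-- The conditions on a pair `θ, ψ` of Schwartz functions on `ℝⁿ`, for the dilation `A`, its unit
ball `B₀ = Δ` and the order `s` of cancellation. -/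
structure IsCalderonPair {n : ℕ} (A : Dilation n) (Δ : Set (Rn n)) (s : ℕ) (θ ψ : 𝓢(Rn n, ℂ)) :
    Prop where
  tsupport_subset : tsupport (θ : Rn n → ℂ) ⊆ Δ
  moments : ∀ γ : Fin n → ℕ, ∑ i, γ i ≤ s →
    ∫ x : Rn n, ((∏ i, x i ^ γ i : ℝ) : ℂ) * θ x = 0
  /-- `θ̂ ≥ C > 0` on some annulus (linear images of round annuli are allowed). -/
  annulus : ∃ (L : Rn n ≃L[ℝ] Rn n) (r R C : ℝ), 0 < r ∧ r < R ∧ 0 < C ∧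
    ∀ ξ : Rn n, r < ‖L ξ‖ → ‖L ξ‖ < R → (𝓕 θ ξ).im = 0 ∧ C ≤ (𝓕 θ ξ).re
  compact_support : HasCompactSupport (𝓕 ψ : 𝓢(Rn n, ℂ))
  away_from_zero : (0 : Rn n) ∉ tsupport (𝓕 ψ : 𝓢(Rn n, ℂ))
  resolution : ∀ ξ : Rn n, ξ ≠ 0 →
    HasSum (fun j : ℤ => 𝓕 ψ ((A.transpose.equiv ^ j) ξ) * 𝓕 θ ((A.transpose.equiv ^ j) ξ)) 1

section Product

variable {n m : ℕ}

theorem contDiff_tensor_fst (φ : 𝓢(Rn n, ℂ)) :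
    ContDiff ℝ (⊤ : ℕ∞) (fun x : RnRm n m => φ x.fst) :=
  (φ.smooth ⊤).comp (WithLp.fstL 2 ℝ (Rn n) (Rn m)).contDiff

theorem contDiff_tensor_snd (φ : 𝓢(Rn m, ℂ)) :
    ContDiff ℝ (⊤ : ℕ∞) (fun x : RnRm n m => φ x.snd) :=
  (φ.smooth ⊤).comp (WithLp.sndL 2 ℝ (Rn n) (Rn m)).contDiff

theorem norm_iteratedFDeriv_comp_le {E F : Type*} [NormedAddCommGroup E] [NormedSpace ℝ E]
    [NormedAddCommGroup F] [NormedSpace ℝ F] (φ : 𝓢(F, ℂ)) (L : E →L[ℝ] F) (hL : ‖L‖ ≤ 1)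
    (i : ℕ) (x : E) :
    ‖iteratedFDeriv ℝ i (fun y => φ (L y)) x‖ ≤ ‖iteratedFDeriv ℝ i φ (L x)‖ := by
  have h := L.iteratedFDeriv_comp_right (φ.smooth ⊤) x (i := i) (by exact_mod_cast le_top)
  change ‖iteratedFDeriv ℝ i (φ ∘ L) x‖ ≤ _
  rw [h]
  refine (ContinuousMultilinearMap.norm_compContinuousLinearMap_le _ _).trans ?_
  refine mul_le_of_le_one_right (norm_nonneg _) ?_
  exact Finset.prod_le_one (fun _ _ => norm_nonneg _) (fun _ _ => hL)

theorem norm_le_fst_add_snd (x : RnRm n m) : ‖x‖ ≤ ‖x.fst‖ + ‖x.snd‖ := by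
  rw [WithLp.prod_norm_eq_of_L2]
  refine Real.sqrt_le_iff.2 ⟨by positivity, ?_⟩
  nlinarith [norm_nonneg x.fst, norm_nonneg x.snd]

/-- The tensor product `(x₁, x₂) ↦ φ₁ x₁ * φ₂ x₂` of two Schwartz functions. -/
noncomputable def tensor (φ₁ : 𝓢(Rn n, ℂ)) (φ₂ : 𝓢(Rn m, ℂ)) : 𝓢(RnRm n m, ℂ) where
  toFun x := φ₁ x.fst * φ₂ x.snd
  smooth' := (contDiff_tensor_fst φ₁).mul (contDiff_tensor_snd φ₂)
  decay' k N := by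
    have hfst : ‖WithLp.fstL 2 ℝ (Rn n) (Rn m)‖ ≤ 1 :=
      ContinuousLinearMap.opNorm_le_bound _ zero_le_one fun x => by
        simpa using WithLp.norm_fst_le _ x
    have hsnd : ‖WithLp.sndL 2 ℝ (Rn n) (Rn m)‖ ≤ 1 :=
      ContinuousLinearMap.opNorm_le_bound _ zero_le_one fun x => by
        simpa using WithLp.norm_snd_le _ x
    set S₁ := 2 ^ k * (Finset.Iic (k, N)).sup (fun p => SchwartzMap.seminorm ℝ p.1 p.2) φ₁
    set S₂ := 2 ^ k * (Finset.Iic (k, N)).sup (fun p => SchwartzMap.seminorm ℝ p.1 p.2) φ₂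
    have hS₁ : 0 ≤ S₁ := by positivity
    refine ⟨∑ i ∈ Finset.range (N + 1), (N.choose i : ℝ) * (S₁ * S₂), fun x => ?_⟩
    have h := norm_iteratedFDeriv_mul_le (contDiff_tensor_fst (m := m) φ₁)
      (contDiff_tensor_snd (n := n) φ₂) x (n := N) (by exact_mod_cast le_top)
    refine (mul_le_mul_of_nonneg_left h (by positivity)).trans ?_
    rw [Finset.mul_sum]
    refine Finset.sum_le_sum fun i hi => ?_
    have hiN : i ≤ N := Finset.mem_range_succ_iff.1 hi
    have h1 := norm_iteratedFDeriv_comp_le φ₁ (WithLp.fstL 2 ℝ (Rn n) (Rn m)) hfst i x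
    have h2 := norm_iteratedFDeriv_comp_le φ₂ (WithLp.sndL 2 ℝ (Rn n) (Rn m)) hsnd (N - i) x
    have b1 := one_add_le_sup_seminorm_apply (𝕜 := ℝ) (m := (k, N)) le_rfl hiN φ₁ x.fst
    have b2 := one_add_le_sup_seminorm_apply (𝕜 := ℝ) (m := (k, N)) le_rfl (Nat.sub_le N i) φ₂ x.snd
    simp only [WithLp.fstL_apply, WithLp.sndL_apply] at h1 h2
    have hx : ‖x‖ ^ k ≤ (1 + ‖x.fst‖) ^ k * (1 + ‖x.snd‖) ^ k := by
      rw [← mul_pow]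
      refine pow_le_pow_left₀ (norm_nonneg _) ?_ k
      nlinarith [norm_le_fst_add_snd x, norm_nonneg x.fst, norm_nonneg x.snd,
        mul_nonneg (norm_nonneg x.fst) (norm_nonneg x.snd)]
    calc ‖x‖ ^ k * ((N.choose i : ℝ) * ‖iteratedFDeriv ℝ i (fun x : RnRm n m => φ₁ x.fst) x‖ *
            ‖iteratedFDeriv ℝ (N - i) (fun x : RnRm n m => φ₂ x.snd) x‖)
        ≤ ((1 + ‖x.fst‖) ^ k * (1 + ‖x.snd‖) ^ k) * ((N.choose i : ℝ) *
            ‖iteratedFDeriv ℝ i φ₁ x.fst‖ * ‖iteratedFDeriv ℝ (N - i) φ₂ x.snd‖) := by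
          gcongr
      _ = (N.choose i : ℝ) * (((1 + ‖x.fst‖) ^ k * ‖iteratedFDeriv ℝ i φ₁ x.fst‖) *
            ((1 + ‖x.snd‖) ^ k * ‖iteratedFDeriv ℝ (N - i) φ₂ x.snd‖)) := by ring
      _ ≤ (N.choose i : ℝ) * (S₁ * S₂) := by
          refine mul_le_mul_of_nonneg_left ?_ (by positivity)
          exact mul_le_mul b1 b2 (by positivity) hS₁

@[simp] theorem tensor_apply (φ₁ : 𝓢(Rn n, ℂ)) (φ₂ : 𝓢(Rn m, ℂ)) (x : RnRm n m) :
    tensor φ₁ φ₂ x = φ₁ x.fst * φ₂ x.snd := rfl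

/-- The automorphism `(x₁, x₂) ↦ (A₁ ^ k₁ x₁, A₂ ^ k₂ x₂)` of `ℝⁿ × ℝᵐ`. -/
noncomputable def prodEquiv (A₁ : Dilation n) (A₂ : Dilation m) (k₁ k₂ : ℤ) :
    RnRm n m ≃L[ℝ] RnRm n m :=
  ((WithLp.prodContinuousLinearEquiv 2 ℝ (Rn n) (Rn m)).trans
    ((A₁.equiv ^ k₁).prodCongr (A₂.equiv ^ k₂))).trans
    (WithLp.prodContinuousLinearEquiv 2 ℝ (Rn n) (Rn m)).symm

/-- `φ_{k₁,k₂}(x) = b₁ ^ (-k₁) b₂ ^ (-k₂) φ (A₁ ^ (-k₁) x₁, A₂ ^ (-k₂) x₂)`. -/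
noncomputable def dilate (A₁ : Dilation n) (A₂ : Dilation m) (k₁ k₂ : ℤ) (φ : 𝓢(RnRm n m, ℂ)) :
    𝓢(RnRm n m, ℂ) :=
  ((A₁.b ^ (-k₁) * A₂.b ^ (-k₂) : ℝ) : ℂ) •
    compCLMOfContinuousLinearEquiv ℂ (prodEquiv A₁ A₂ (-k₁) (-k₂)) φ

theorem dilate_apply (A₁ : Dilation n) (A₂ : Dilation m) (k₁ k₂ : ℤ) (φ : 𝓢(RnRm n m, ℂ))
    (x : RnRm n m) :
    dilate A₁ A₂ k₁ k₂ φ x = ((A₁.b ^ (-k₁) * A₂.b ^ (-k₂) : ℝ) : ℂ) *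
      φ (WithLp.toLp 2 ((A₁.equiv ^ (-k₁)) x.fst, (A₂.equiv ^ (-k₂)) x.snd)) := rfl

/-- The convolution of two Schwartz functions (it agrees pointwise with the convolution integral,
see `SchwartzMap.convolution_apply`). -/
noncomputable def convS (f g : 𝓢(RnRm n m, ℂ)) : 𝓢(RnRm n m, ℂ) :=
  SchwartzMap.convolution (ContinuousLinearMap.mul ℂ ℂ) f g

/-- The reflection `x ↦ φ (-x)`. -/
noncomputable def reflect (φ : 𝓢(RnRm n m, ℂ)) : 𝓢(RnRm n m, ℂ) :=
  compCLMOfContinuousLinearEquiv ℂ (ContinuousLinearEquiv.neg ℝ) φ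

/-- The convolution of a tempered distribution with a Schwartz function:
`⟨f ∗ φ, h⟩ = ⟨f, φ(-·) ∗ h⟩`. -/
noncomputable def convD (f : 𝓢'(RnRm n m, ℂ)) (φ : 𝓢(RnRm n m, ℂ)) : 𝓢'(RnRm n m, ℂ) :=
  PointwiseConvergenceCLM.precomp ℂ
    (SchwartzMap.convolution (ContinuousLinearMap.mul ℂ ℂ) (reflect φ)) f

theorem convD_apply (f : 𝓢'(RnRm n m, ℂ)) (φ h : 𝓢(RnRm n m, ℂ)) :
    convD f φ h = f (convS (reflect φ) h) := rfl

/-- The convolution integral `(f ∗ φ)(x) = ∫ f(t) φ(x - t) dt` of a function with a Schwartz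
function. -/
noncomputable def convF (f : RnRm n m → ℂ) (φ : 𝓢(RnRm n m, ℂ)) : RnRm n m → ℂ :=
  fun x => ∫ t, f t * φ (x - t)

/-- The class `𝒮_{s₁,s₂}`: vanishing moments up to order `s₁` in the first variable and up to order
`s₂` in the second one. -/
def HasVanishingMoments (s₁ s₂ : ℕ) (f : 𝓢(RnRm n m, ℂ)) : Prop :=
  (∀ γ : Fin n → ℕ, ∑ i, γ i ≤ s₁ → ∀ x₂ : Rn m,
    ∫ x₁ : Rn n, f (WithLp.toLp 2 (x₁, x₂)) * ((∏ i, x₁ i ^ γ i : ℝ) : ℂ) = 0) ∧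
  (∀ β : Fin m → ℕ, ∑ i, β i ≤ s₂ → ∀ x₁ : Rn n,
    ∫ x₂ : Rn m, f (WithLp.toLp 2 (x₁, x₂)) * ((∏ i, x₂ i ^ β i : ℝ) : ℂ) = 0)

/-- The class `𝒮_∞`, the intersection of all the `𝒮_{s₁,s₂}`. -/
def MemSInfty (f : 𝓢(RnRm n m, ℂ)) : Prop :=
  ∀ s₁ s₂ : ℕ, HasVanishingMoments s₁ s₂ f

/-- `f` vanishes weakly at infinity: for all `φ = φ⁽¹⁾ φ⁽²⁾`, the distributions `f ∗ φ_{k₁,k₂}` tend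
to `0` as `k₁ → ∞` or `k₂ → ∞`, that is, as `max k₁ k₂ → ∞`. (Requiring this only when both indices
tend to infinity would admit `f(x₁, x₂) = g(x₁)`, with `g` a Schwartz function.) -/
def VanishesWeaklyAtInfinity (A₁ : Dilation n) (A₂ : Dilation m) (f : 𝓢'(RnRm n m, ℂ)) : Prop :=
  ∀ (φ₁ : 𝓢(Rn n, ℂ)) (φ₂ : 𝓢(Rn m, ℂ)),
    Tendsto (fun k : ℤ × ℤ => convD f (dilate A₁ A₂ k.1 k.2 (tensor φ₁ φ₂)))
      (comap (fun k : ℤ × ℤ => max k.1 k.2) atTop) (𝓝 0)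

end Product

end AnisoCalderon

/-!
On the Fourier side the operator `f ↦ f ∗ ψ_{j₁,j₂} ∗ θ_{j₁,j₂}` is multiplication by `g₁ ((A₁*)^j₁
ξ₁) g₂ ((A₂*)^j₂ ξ₂)`, where `gᵢ = ψ̂ᵢ θ̂ᵢ` is smooth, compactly supported away from the origin, and
has dilates summing to `1` off the origin (`IsAnnularResolution`). The inclusion `r B₀ ⊆ A B₀` says
that `A⁻¹` contracts by `r⁻¹` in the norm with unit ball `B₀`, so the powers of `A*` expand
geometrically (`Dilation.IsUnitBall.exists_expands`). The three statements concern the convergence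
of the same sum of multipliers to `1`.

In `L²`: an orbit of `A*` meets an annulus a bounded number of times, so all finite sums of the
multipliers are bounded by one constant (`IsAnnularResolution.exists_norm_sum_prod_le`), and they
tend to `1` off the two coordinate subspaces, which are null sets. By Plancherel and dominated
convergence this gives the convergence for Schwartz `f`, and uniform boundedness extends it to all
of `L²` (`tendsto_eLpNorm_sub_convFun`).

In the Schwartz space: the moment conditions say that `f̂` vanishes to infinite order on both
coordinate subspaces (`MemSInfty.flatOn_fst`, `MemSInfty.flatOn_snd`). A dilate of `gᵢ` by a large
positive power lives near the subspace, where this vanishing outweighs the growth of the derivatives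
of the multiplier; a dilate by a large negative power lives far away, where `f̂` decays. Hence every
Schwartz seminorm of the pieces of `f̂` decays geometrically in `|j₁| + |j₂|`
(`Expands.seminorm_mulComp_zpow_le`), which together with pointwise convergence gives convergence in
the Schwartz space (`hasSum_schwartz`).

In the tempered distributions: `∑_{j ≥ 0} gᵢ ((Aᵢ*)^j ξ)` extends to a test function `φᵢ` equal to
`1` near the origin (`IsAnnularResolution.exists_lowPass`), and `gᵢ = φᵢ - φᵢ ∘ Aᵢ*`. A rectangular
partial sum therefore telescopes to four convolutions of `f` with dilates of the inverse Fourier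
transform of `φ₁ ⊗ φ₂`, one for each corner (`sum_convS_dilate_eq`). The three corners with an upper
index tend to zero because `f` vanishes weakly at infinity, and the lower corner is an approximate
identity (`tendsto_convD_dilate`).
-/

namespace AnisoCalderon

/-! ### Multipliers on the Schwartz space and expansive maps -/

section MultiplierEstimates

open scoped ContDiff

variable {E V : Type*} [NormedAddCommGroup E] [NormedSpace ℝ E]
  [NormedAddCommGroup V] [NormedSpace ℝ V]

/-- A smooth function all of whose derivatives are bounded. -/
structure BoundedDerivs (g : V → ℂ) : Prop where
  contDiff : ContDiff ℝ ∞ g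
  bound : ∀ l : ℕ, ∃ B : ℝ, ∀ x, ‖iteratedFDeriv ℝ l g x‖ ≤ B

theorem BoundedDerivs.of_schwartz (φ : 𝓢(V, ℂ)) : BoundedDerivs φ where
  contDiff := φ.smooth ⊤
  bound l := ⟨_, fun x => φ.norm_iteratedFDeriv_le_seminorm ℝ l x⟩

theorem BoundedDerivs.one_sub {g : V → ℂ} (hg : BoundedDerivs g) :
    BoundedDerivs (fun x => 1 - g x) where
  contDiff := contDiff_const.sub hg.contDiff
  bound l := by
    obtain ⟨B, hB⟩ := hg.bound l
    rcases Nat.eq_zero_or_pos l with rfl | hl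
    · refine ⟨1 + B, fun x => ?_⟩
      have := hB x
      rw [norm_iteratedFDeriv_zero] at this ⊢
      exact (norm_sub_le _ _).trans (by simpa using this)
    · refine ⟨B, fun x => ?_⟩
      have hx : iteratedFDeriv ℝ l (fun x => 1 - g x) x = -iteratedFDeriv ℝ l g x := by
        have h := iteratedFDeriv_sub (𝕜 := ℝ) (i := l) (f := fun _ : V => (1 : ℂ)) (g := g)
          contDiff_const (hg.contDiff.of_le (by exact_mod_cast le_top))
        change iteratedFDeriv ℝ l ((fun _ : V => (1 : ℂ)) - g) x = _
        rw [h, iteratedFDeriv_const_of_ne hl.ne']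
        simp
      rw [hx, norm_neg]
      exact hB x

theorem BoundedDerivs.hasTemperateGrowth {g : V → ℂ} (hg : BoundedDerivs g) :
    g.HasTemperateGrowth := by
  refine ⟨hg.contDiff, fun l => ?_⟩
  obtain ⟨B, hB⟩ := hg.bound l
  exact ⟨0, B, fun x => by simpa using hB x⟩

theorem BoundedDerivs.comp_hasTemperateGrowth {g : V → ℂ} (hg : BoundedDerivs g) (T : E →L[ℝ] V) :
    (g ∘ T).HasTemperateGrowth :=
  hg.hasTemperateGrowth.comp T.hasTemperateGrowth

/-- The Schwartz function `x ↦ g (T x) * F x`, for `g` with bounded derivatives and `T` linear. -/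
noncomputable def mulComp (g : V → ℂ) (T : E →L[ℝ] V) : 𝓢(E, ℂ) →L[ℂ] 𝓢(E, ℂ) :=
  smulLeftCLM ℂ (g ∘ T)

theorem mulComp_apply {g : V → ℂ} (hg : BoundedDerivs g) (T : E →L[ℝ] V) (F : 𝓢(E, ℂ)) (x : E) :
    mulComp g T F x = g (T x) * F x := by
  simp [mulComp, smulLeftCLM_apply_apply (hg.comp_hasTemperateGrowth T)]

/-- The supremum of the Schwartz seminorms of indices at most `k` and `l`. -/
noncomputable def supSeminorm (k l : ℕ) : Seminorm ℂ 𝓢(E, ℂ) :=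
  (Finset.Iic (k, l)).sup (schwartzSeminormFamily ℂ E ℂ)

theorem seminorm_le_supSeminorm {k l k' l' : ℕ} (hk : k ≤ k') (hl : l ≤ l') (F : 𝓢(E, ℂ)) :
    SchwartzMap.seminorm ℂ k l F ≤ supSeminorm k' l' F :=
  Seminorm.le_def.1 (Finset.le_sup (f := schwartzSeminormFamily ℂ E ℂ)
    (Finset.mem_Iic.2 (Prod.mk_le_mk.2 ⟨hk, hl⟩))) F

theorem supSeminorm_mono {k l k' l' : ℕ} (hk : k ≤ k') (hl : l ≤ l') (F : 𝓢(E, ℂ)) :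
    supSeminorm k l F ≤ supSeminorm k' l' F :=
  Seminorm.le_def.1 (Finset.sup_mono (f := schwartzSeminormFamily ℂ E ℂ)
    (Finset.Iic_subset_Iic.2 (Prod.mk_le_mk.2 ⟨hk, hl⟩))) F

theorem supSeminorm_le {k l : ℕ} {F : 𝓢(E, ℂ)} {M : ℝ} (hM : 0 ≤ M)
    (h : ∀ k' l', k' ≤ k → l' ≤ l → SchwartzMap.seminorm ℂ k' l' F ≤ M) :
    supSeminorm k l F ≤ M := by
  refine Seminorm.finset_sup_apply_le hM fun p hp => ?_
  obtain ⟨h1, h2⟩ := Prod.mk_le_mk.1 (Finset.mem_Iic.1 hp)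
  exact h p.1 p.2 h1 h2

theorem iteratedFDeriv_mulComp_eq_zero {g : V → ℂ} (hg : BoundedDerivs g) (T : E →L[ℝ] V)
    (F : 𝓢(E, ℂ)) (l : ℕ) {x : E} (hx : T x ∉ tsupport g) :
    iteratedFDeriv ℝ l (mulComp g T F) x = 0 := by
  have h : (mulComp g T F : E → ℂ) =ᶠ[𝓝 x] fun _ => 0 := by
    have h1 := (notMem_tsupport_iff_eventuallyEq.1 hx)
    filter_upwards [T.continuous.continuousAt.eventually h1] with y hy
    rw [mulComp_apply hg, hy]
    simp
  rw [(h.iteratedFDeriv ℝ l).eq_of_nhds]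
  simp

/-- Leibniz estimate: differentiating `g (T x) * F x` costs at most a factor `max 1 ‖T‖` per
derivative. -/
theorem exists_norm_iteratedFDeriv_mulComp_le {g : V → ℂ} (hg : BoundedDerivs g) (l : ℕ) :
    ∃ B : ℝ, 0 ≤ B ∧ ∀ (T : E →L[ℝ] V) (F : 𝓢(E, ℂ)) (x : E) (S : ℝ),
      (∀ i ≤ l, ‖iteratedFDeriv ℝ i F x‖ ≤ S) →
      ‖iteratedFDeriv ℝ l (mulComp g T F) x‖ ≤ B * (max 1 ‖T‖) ^ l * S := by
  choose B hB using hg.bound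
  have hB0 : ∀ i, 0 ≤ B i := fun i => (norm_nonneg _).trans (hB i 0)
  refine ⟨∑ i ∈ Finset.range (l + 1), (l.choose i : ℝ) * B i,
    Finset.sum_nonneg fun i _ => mul_nonneg (by positivity) (hB0 i), fun T F x S hS => ?_⟩
  have hgT : ContDiff ℝ (l : ℕ) (g ∘ T) :=
    (hg.contDiff.of_le (by exact_mod_cast le_top)).comp T.contDiff
  have h := norm_iteratedFDeriv_mul_le (n := l) hgT (F.smooth l) x le_rfl
  have heq : (mulComp g T F : E → ℂ) = fun y => (g ∘ T) y * F y := by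
    ext y; exact mulComp_apply hg T F y
  rw [heq]
  refine h.trans ?_
  rw [Finset.sum_mul, Finset.sum_mul]
  refine Finset.sum_le_sum fun i hi => ?_
  have hil : i ≤ l := Finset.mem_range_succ_iff.1 hi
  have h1 : ‖iteratedFDeriv ℝ i (g ∘ T) x‖ ≤ B i * (max 1 ‖T‖) ^ l := by
    rw [T.iteratedFDeriv_comp_right hg.contDiff x (i := i) (by exact_mod_cast le_top)]
    refine (ContinuousMultilinearMap.norm_compContinuousLinearMap_le _ _).trans ?_
    rw [Finset.prod_const, Finset.card_univ, Fintype.card_fin]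
    refine mul_le_mul (hB i _) ?_ (by positivity) (hB0 i)
    exact (pow_le_pow_left₀ (norm_nonneg _) (le_max_right _ _) i).trans
      (pow_le_pow_right₀ (le_max_left _ _) hil)
  calc _ ≤ (l.choose i : ℝ) * (B i * (max 1 ‖T‖) ^ l) * S := by
        gcongr
        · exact mul_nonneg (by positivity) (mul_nonneg (hB0 i) (by positivity))
        · exact hS _ (Nat.sub_le _ _)
    _ = _ := by ring

/-- If `g` vanishes near the origin, then multiplication by `g ∘ T` is small when `T` is: on the
support of `g ∘ T` the norm of `x` is at least a multiple of `‖T‖⁻¹`, and `F` decays. -/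
theorem seminorm_mulComp_le_of_away {g : V → ℂ} (hg : BoundedDerivs g) {δ : ℝ} (hδ : 0 < δ)
    (hsupp : ∀ v ∈ tsupport g, δ ≤ ‖v‖) (k l : ℕ) (Λ : ℝ) :
    ∃ K : ℝ, 0 ≤ K ∧ ∀ T : E →L[ℝ] V, ‖T‖ ≤ Λ → ∀ F : 𝓢(E, ℂ),
      SchwartzMap.seminorm ℂ k l (mulComp g T F) ≤ K * ‖T‖ * supSeminorm (k + 1) l F := by
  obtain ⟨B, hB0, hB⟩ := exists_norm_iteratedFDeriv_mulComp_le (E := E) hg l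
  refine ⟨B * (max 1 Λ) ^ l / δ, by positivity, fun T hT F => ?_⟩
  refine SchwartzMap.seminorm_le_bound ℂ k l _ (by positivity) fun x => ?_
  by_cases hx : T x ∈ tsupport g
  swap
  · rw [iteratedFDeriv_mulComp_eq_zero hg T F l hx]
    simp only [norm_zero, mul_zero]
    positivity
  have hx1 : δ ≤ ‖T‖ * ‖x‖ := (hsupp _ hx).trans (T.le_opNorm x)
  have hx0 : 0 < ‖x‖ := by
    by_contra h0
    have : ‖x‖ = 0 := le_antisymm (not_lt.1 h0) (norm_nonneg _)
    rw [this, mul_zero] at hx1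
    linarith
  have hS := hB T F x (supSeminorm (k + 1) l F / ‖x‖ ^ (k + 1)) fun i hi => by
    rw [le_div_iff₀' (by positivity)]
    exact (F.le_seminorm ℂ (k + 1) i x).trans (seminorm_le_supSeminorm le_rfl hi F)
  calc ‖x‖ ^ k * ‖iteratedFDeriv ℝ l (mulComp g T F) x‖
      ≤ ‖x‖ ^ k * (B * (max 1 Λ) ^ l * (supSeminorm (k + 1) l F / ‖x‖ ^ (k + 1))) := by
        refine mul_le_mul_of_nonneg_left (hS.trans ?_) (by positivity)
        have : max 1 ‖T‖ ≤ max 1 Λ := max_le_max le_rfl hT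
        gcongr
    _ = B * (max 1 Λ) ^ l * supSeminorm (k + 1) l F * (1 / ‖x‖) := by
        field_simp
        ring
    _ ≤ B * (max 1 Λ) ^ l * supSeminorm (k + 1) l F * (‖T‖ / δ) := by
        refine mul_le_mul_of_nonneg_left ?_ (by positivity)
        rw [div_le_div_iff₀ hx0 hδ]
        linarith
    _ = _ := by ring

/-- `F` vanishes to infinite order on the subspace `P x = 0`. -/
def FlatOn (P : E →L[ℝ] V) (F : 𝓢(E, ℂ)) : Prop :=
  ∀ (l : ℕ) (x : E), P x = 0 → iteratedFDeriv ℝ l F x = 0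

/-- `Q` is a projection of `E` onto the kernel of `P` that does not increase norms, and `P`
controls the complementary projection. -/
structure IsComplProj (P : E →L[ℝ] V) (Q : E →L[ℝ] E) : Prop where
  norm_le : ∀ x, ‖P x‖ ≤ ‖x‖
  map_proj : ∀ x, P (Q x) = 0
  proj_proj : ∀ x, Q (Q x) = Q x
  norm_proj_le : ∀ x, ‖Q x‖ ≤ ‖x‖
  norm_sub_le : ∀ x, ‖x - Q x‖ ≤ ‖P x‖

/-- A Schwartz function that is flat on `P x = 0` is `O(‖P x‖ ^ N)` together with its derivatives,
uniformly with rapid decay along the subspace. The proof integrates `N` times from `Q x` to `x`. -/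
theorem FlatOn.norm_iteratedFDeriv_le {P : E →L[ℝ] V} {Q : E →L[ℝ] E} (hPQ : IsComplProj P Q)
    {F : 𝓢(E, ℂ)} (hF : FlatOn P F) (k N : ℕ) (l : ℕ) (x : E) :
    (1 + ‖Q x‖) ^ k * ‖iteratedFDeriv ℝ l F x‖ ≤
      2 ^ k * supSeminorm k (l + N) F * ‖P x‖ ^ N := by
  induction N generalizing l x with
  | zero =>
    have h := one_add_le_sup_seminorm_apply (𝕜 := ℂ) (m := (k, l)) le_rfl le_rfl F x
    have hQ := hPQ.norm_proj_le x
    simp only [add_zero, pow_zero, mul_one]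
    refine le_trans ?_ h
    gcongr
  | succ N ih =>
    have hseg := (convex_segment (𝕜 := ℝ) (Q x) x).norm_image_sub_le_of_norm_fderiv_le (𝕜 := ℝ)
      (f := iteratedFDeriv ℝ l F)
      (C := 2 ^ k * supSeminorm k (l + (N + 1)) F * ‖P x‖ ^ N / (1 + ‖Q x‖) ^ k)
      (x := Q x) (y := x) (fun y _ =>
        ((F.smooth ⊤).differentiable_iteratedFDeriv
          (by exact_mod_cast ENat.natCast_lt_top l)).differentiableAt)
      (fun y hy => by
        rw [norm_fderiv_iteratedFDeriv]
        rw [le_div_iff₀' (by positivity)]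
        obtain ⟨a, b, ha, hb, hab, rfl⟩ := hy
        have h1 := ih (l + 1) (a • Q x + b • x)
        have hQ : Q (a • Q x + b • x) = Q x := by
          rw [map_add, map_smul, map_smul, hPQ.proj_proj, ← add_smul, hab, one_smul]
        have hP : ‖P (a • Q x + b • x)‖ ≤ ‖P x‖ := by
          rw [map_add, map_smul, map_smul, hPQ.map_proj, smul_zero, zero_add, norm_smul,
            Real.norm_of_nonneg hb]
          exact mul_le_of_le_one_left (norm_nonneg _) (by linarith)
        rw [hQ, show l + 1 + N = l + (N + 1) by ring] at h1
        refine h1.trans ?_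
        gcongr)
      (left_mem_segment ℝ _ _) (right_mem_segment ℝ _ _)
    rw [hF l (Q x) (hPQ.map_proj x), sub_zero] at hseg
    have h2 : ‖iteratedFDeriv ℝ l F x‖ ≤
        2 ^ k * supSeminorm k (l + (N + 1)) F * ‖P x‖ ^ N / (1 + ‖Q x‖) ^ k * ‖P x‖ :=
      hseg.trans (by gcongr; exact hPQ.norm_sub_le x)
    calc _ ≤ (1 + ‖Q x‖) ^ k *
          (2 ^ k * supSeminorm k (l + (N + 1)) F * ‖P x‖ ^ N / (1 + ‖Q x‖) ^ k * ‖P x‖) := by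
          gcongr
      _ = _ := by
          have : (1 + ‖Q x‖) ^ k ≠ 0 := by positivity
          field_simp
          ring

/-- If `g` is compactly supported, `F` is flat on `P x = 0` and `τ` expands by the factor `c⁻¹`,
then multiplication by `g ∘ τ ∘ P` gains any power of `c`. -/
theorem seminorm_mulComp_le_of_flat {P : E →L[ℝ] V} {Q : E →L[ℝ] E} (hPQ : IsComplProj P Q)
    {g : V → ℂ} (hg : BoundedDerivs g) {b : ℝ} (hb : 0 ≤ b)
    (hsupp : ∀ v ∈ tsupport g, ‖v‖ ≤ b) (k l N : ℕ) (C : ℝ) :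
    ∃ K : ℝ, 0 ≤ K ∧ ∀ (τ : V →L[ℝ] V) (c : ℝ), 0 ≤ c → c ≤ C → (∀ v, ‖v‖ ≤ c * ‖τ v‖) →
      ∀ F : 𝓢(E, ℂ), FlatOn P F → SchwartzMap.seminorm ℂ k l (mulComp g (τ ∘L P) F) ≤
        K * (max 1 ‖τ‖) ^ l * c ^ N * supSeminorm k (l + N) F := by
  obtain ⟨B, hB0, hB⟩ := exists_norm_iteratedFDeriv_mulComp_le (E := E) hg l
  refine ⟨B * (max 1 (1 + C * b)) ^ k * 2 ^ k * b ^ N, by positivity,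
    fun τ c hc0 hc hτ F hF => ?_⟩
  refine SchwartzMap.seminorm_le_bound ℂ k l _ (by positivity) fun x => ?_
  by_cases hx : (τ ∘L P) x ∈ tsupport g
  swap
  · rw [iteratedFDeriv_mulComp_eq_zero hg _ F l hx]
    simp only [norm_zero, mul_zero]
    positivity
  have hPx : ‖P x‖ ≤ c * b := (hτ (P x)).trans (by gcongr; exact hsupp _ hx)
  have hPx' : ‖P x‖ ≤ C * b := hPx.trans (by gcongr)
  have hx1 : ‖x‖ ≤ max 1 (1 + C * b) * (1 + ‖Q x‖) := by
    calc ‖x‖ = ‖Q x + (x - Q x)‖ := by congr 1; abel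
      _ ≤ ‖Q x‖ + ‖P x‖ := (norm_add_le _ _).trans (by gcongr; exact hPQ.norm_sub_le x)
      _ ≤ (1 + C * b) * (1 + ‖Q x‖) := by
        nlinarith [norm_nonneg (Q x), mul_nonneg ((norm_nonneg (P x)).trans hPx')
          (norm_nonneg (Q x))]
      _ ≤ _ := by gcongr; exact le_max_right _ _
  have hS := hB (τ ∘L P) F x
    (2 ^ k * supSeminorm k (l + N) F * (c * b) ^ N / (1 + ‖Q x‖) ^ k) fun i hi => by
    rw [le_div_iff₀' (by positivity)]
    refine (hF.norm_iteratedFDeriv_le hPQ k N i x).trans ?_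
    have := supSeminorm_mono (le_refl k) (show i + N ≤ l + N by lia) F
    gcongr
  have hτP : ‖τ ∘L P‖ ≤ ‖τ‖ := by
    refine (τ.opNorm_comp_le P).trans (mul_le_of_le_one_right (norm_nonneg _) ?_)
    exact P.opNorm_le_bound zero_le_one fun y => by simpa using hPQ.norm_le y
  calc ‖x‖ ^ k * ‖iteratedFDeriv ℝ l (mulComp g (τ ∘L P) F) x‖
      ≤ (max 1 (1 + C * b) * (1 + ‖Q x‖)) ^ k * (B * (max 1 ‖τ‖) ^ l *
        (2 ^ k * supSeminorm k (l + N) F * (c * b) ^ N / (1 + ‖Q x‖) ^ k)) := by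
        refine mul_le_mul (by gcongr) (hS.trans ?_) (norm_nonneg _) (by positivity)
        have : max 1 ‖τ ∘L P‖ ≤ max 1 ‖τ‖ := max_le_max le_rfl hτP
        gcongr
    _ = _ := by
        have : (1 + ‖Q x‖) ^ k ≠ 0 := by positivity
        rw [mul_pow, mul_pow]
        field_simp

/-- `T` is expansive: its positive powers expand at the geometric rate `ρ⁻¹`. -/
structure Expands (T : V ≃L[ℝ] V) (C ρ : ℝ) : Prop where
  const_pos : 0 < C
  rate_pos : 0 < ρ
  rate_lt_one : ρ < 1
  norm_le : ∀ (n : ℕ) (v : V), ‖v‖ ≤ C * ρ ^ n * ‖(T ^ n) v‖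

variable {T : V ≃L[ℝ] V} {C ρ : ℝ}

theorem Expands.norm_zpow_le (hT : Expands T C ρ) (j : ℤ) (n : ℕ) (v : V) :
    ‖(T ^ j) v‖ ≤ C * ρ ^ n * ‖(T ^ (j + n)) v‖ := by
  have h := hT.norm_le n ((T ^ j) v)
  rw [add_comm, zpow_add, zpow_natCast]
  exact h

theorem Expands.norm_zpow_neg_le (hT : Expands T C ρ) (n : ℕ) :
    ‖((T ^ (-(n : ℤ)) : V ≃L[ℝ] V) : V →L[ℝ] V)‖ ≤ C * ρ ^ n := by
  have := hT.const_pos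
  have := hT.rate_pos
  refine ContinuousLinearMap.opNorm_le_bound _ (by positivity) fun v => ?_
  have h := hT.norm_zpow_le (-n) n v
  rw [neg_add_cancel, zpow_zero] at h
  exact h

theorem norm_equiv_pow_le (T : V ≃L[ℝ] V) (n : ℕ) :
    ‖((T ^ n : V ≃L[ℝ] V) : V →L[ℝ] V)‖ ≤ (max 1 ‖(T : V →L[ℝ] V)‖) ^ n := by
  induction n with
  | zero =>
    rw [pow_zero, pow_zero]
    exact ContinuousLinearMap.norm_id_le
  | succ n ih =>
    refine ContinuousLinearMap.opNorm_le_bound _ (by positivity) fun v => ?_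
    rw [pow_succ, pow_succ]
    change ‖(T ^ n) (T v)‖ ≤ _
    calc ‖(T ^ n) (T v)‖ ≤ (max 1 ‖(T : V →L[ℝ] V)‖) ^ n * ‖T v‖ :=
          ((T ^ n : V ≃L[ℝ] V) : V →L[ℝ] V).le_of_opNorm_le ih _
      _ ≤ (max 1 ‖(T : V →L[ℝ] V)‖) ^ n * (max 1 ‖(T : V →L[ℝ] V)‖ * ‖v‖) := by
          gcongr
          exact (T : V →L[ℝ] V).le_of_opNorm_le (le_max_right _ _) v
      _ = _ := by ring

/-- The pieces of a flat Schwartz function cut out by the dilates of an annular multiplier decay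
geometrically in every seminorm. -/
theorem Expands.seminorm_mulComp_zpow_le (hT : Expands T C ρ) {P : E →L[ℝ] V} {Q : E →L[ℝ] E}
    (hPQ : IsComplProj P Q) {g : V → ℂ} (hg : BoundedDerivs g) {δ b : ℝ} (hδ : 0 < δ)
    (hb : 0 ≤ b) (hsupp : ∀ v ∈ tsupport g, δ ≤ ‖v‖ ∧ ‖v‖ ≤ b) (k l : ℕ) :
    ∃ (K : ℝ) (k' l' : ℕ), 0 ≤ K ∧ ∀ (j : ℤ) (F : 𝓢(E, ℂ)), FlatOn P F →
      SchwartzMap.seminorm ℂ k l (mulComp g (((T ^ j : V ≃L[ℝ] V) : V →L[ℝ] V) ∘L P) F) ≤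
        K * ρ ^ j.natAbs * supSeminorm k' l' F := by
  have hC := hT.const_pos
  have hρ := hT.rate_pos
  set Λ := max 1 ‖(T : V →L[ℝ] V)‖
  have hΛ : 1 ≤ Λ := le_max_left _ _
  -- enough orders of vanishing to absorb the growth of `l` derivatives of `g ∘ T ^ j`
  obtain ⟨N, hN⟩ : ∃ N : ℕ, ρ ^ N * Λ ^ l ≤ 1 := by
    have h := (tendsto_pow_atTop_nhds_zero_of_lt_one hρ.le hT.rate_lt_one).mul_const (Λ ^ l)
    rw [zero_mul] at h
    obtain ⟨N, hN⟩ := (h.eventually (gt_mem_nhds one_pos)).exists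
    exact ⟨N, hN.le⟩
  obtain ⟨K₁, hK₁, h₁⟩ := seminorm_mulComp_le_of_away (E := E) hg hδ (fun v hv => (hsupp v hv).1)
    k l C
  obtain ⟨K₂, hK₂, h₂⟩ := seminorm_mulComp_le_of_flat hPQ hg hb (fun v hv => (hsupp v hv).2)
    k l (N + 1) C
  refine ⟨K₁ * C + K₂ * C ^ (N + 1), k + 1, l + (N + 1), by positivity, fun j F hF => ?_⟩
  have hP1 : ‖P‖ ≤ 1 := P.opNorm_le_bound zero_le_one fun y => by simpa using hPQ.norm_le y
  obtain ⟨n, rfl | rfl⟩ := j.eq_nat_or_neg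
  · rw [Int.natAbs_natCast, zpow_natCast]
    have hρn : ρ ^ n ≤ 1 := pow_le_one₀ hρ.le hT.rate_lt_one.le
    have h := h₂ ((T ^ n : V ≃L[ℝ] V) : V →L[ℝ] V) (C * ρ ^ n) (by positivity)
      (mul_le_of_le_one_right hC.le hρn) (hT.norm_le n) F hF
    refine h.trans ?_
    have hn : max 1 ‖((T ^ n : V ≃L[ℝ] V) : V →L[ℝ] V)‖ ≤ Λ ^ n :=
      max_le (one_le_pow₀ hΛ) (norm_equiv_pow_le T n)
    calc K₂ * (max 1 ‖((T ^ n : V ≃L[ℝ] V) : V →L[ℝ] V)‖) ^ l * (C * ρ ^ n) ^ (N + 1) *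
          supSeminorm k (l + (N + 1)) F
        ≤ K₂ * (Λ ^ n) ^ l * (C * ρ ^ n) ^ (N + 1) * supSeminorm (k + 1) (l + (N + 1)) F := by
          have := supSeminorm_mono (Nat.le_succ k) (le_refl (l + (N + 1))) F
          gcongr
      _ = K₂ * C ^ (N + 1) * ρ ^ n * (ρ ^ N * Λ ^ l) ^ n *
          supSeminorm (k + 1) (l + (N + 1)) F := by ring
      _ ≤ K₂ * C ^ (N + 1) * ρ ^ n * 1 * supSeminorm (k + 1) (l + (N + 1)) F := by
          have : (ρ ^ N * Λ ^ l) ^ n ≤ 1 := pow_le_one₀ (by positivity) hN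
          gcongr
      _ ≤ _ := by
          rw [mul_one]
          gcongr
          exact le_add_of_nonneg_left (by positivity)
  · rw [Int.natAbs_neg, Int.natAbs_natCast]
    have hn : ‖((T ^ (-(n : ℤ)) : V ≃L[ℝ] V) : V →L[ℝ] V) ∘L P‖ ≤ C * ρ ^ n :=
      (ContinuousLinearMap.opNorm_comp_le _ _).trans
        ((mul_le_of_le_one_right (norm_nonneg _) hP1).trans (hT.norm_zpow_neg_le n))
    have hρn : ρ ^ n ≤ 1 := pow_le_one₀ hρ.le hT.rate_lt_one.le
    refine (h₁ _ (hn.trans (mul_le_of_le_one_right hC.le hρn)) F).trans ?_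
    calc K₁ * ‖((T ^ (-(n : ℤ)) : V ≃L[ℝ] V) : V →L[ℝ] V) ∘L P‖ * supSeminorm (k + 1) l F
        ≤ K₁ * (C * ρ ^ n) * supSeminorm (k + 1) (l + (N + 1)) F := by
          have := supSeminorm_mono (le_refl (k + 1)) (Nat.le_add_right l (N + 1)) F
          gcongr
      _ = K₁ * C * ρ ^ n * supSeminorm (k + 1) (l + (N + 1)) F := by ring
      _ ≤ _ := by
          gcongr
          exact le_add_of_nonneg_right (by positivity)

theorem Expands.supSeminorm_mulComp_zpow_le (hT : Expands T C ρ) {P : E →L[ℝ] V} {Q : E →L[ℝ] E}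
    (hPQ : IsComplProj P Q) {g : V → ℂ} (hg : BoundedDerivs g) {δ b : ℝ} (hδ : 0 < δ)
    (hb : 0 ≤ b) (hsupp : ∀ v ∈ tsupport g, δ ≤ ‖v‖ ∧ ‖v‖ ≤ b) (k l : ℕ) :
    ∃ (K : ℝ) (k' l' : ℕ), 0 ≤ K ∧ ∀ (j : ℤ) (F : 𝓢(E, ℂ)), FlatOn P F →
      supSeminorm k l (mulComp g (((T ^ j : V ≃L[ℝ] V) : V →L[ℝ] V) ∘L P) F) ≤
        K * ρ ^ j.natAbs * supSeminorm k' l' F := by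
  have hρ := hT.rate_pos
  choose K k' l' hK h using fun k l => hT.seminorm_mulComp_zpow_le hPQ hg hδ hb hsupp k l
  set I := Finset.Iic (k, l)
  refine ⟨∑ p ∈ I, K p.1 p.2, I.sup fun p => k' p.1 p.2, I.sup fun p => l' p.1 p.2,
    Finset.sum_nonneg fun p _ => hK _ _, fun j F hF => ?_⟩
  have hsum : 0 ≤ ∑ p ∈ I, K p.1 p.2 := Finset.sum_nonneg fun p _ => hK _ _
  refine supSeminorm_le (by positivity) fun a c ha hc => ?_
  have hI : (a, c) ∈ I := Finset.mem_Iic.2 (Prod.mk_le_mk.2 ⟨ha, hc⟩)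
  refine (h a c j F hF).trans ?_
  have h1 : K a c ≤ ∑ p ∈ I, K p.1 p.2 :=
    Finset.single_le_sum (f := fun p : ℕ × ℕ => K p.1 p.2) (fun p _ => hK _ _) hI
  have h2 := supSeminorm_mono (Finset.le_sup (f := fun p : ℕ × ℕ => k' p.1 p.2) hI)
    (Finset.le_sup (f := fun p : ℕ × ℕ => l' p.1 p.2) hI) F
  gcongr

/-- Multiplication by a function with bounded derivatives preserves flatness. -/
theorem FlatOn.mulComp {W : Type*} [NormedAddCommGroup W] [NormedSpace ℝ W] {P : E →L[ℝ] W}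
    {F : 𝓢(E, ℂ)} (hF : FlatOn P F) {g : V → ℂ} (hg : BoundedDerivs g) (S : E →L[ℝ] V) :
    FlatOn P (AnisoCalderon.mulComp g S F) := by
  intro l x hx
  obtain ⟨B, -, hB⟩ := exists_norm_iteratedFDeriv_mulComp_le (E := E) hg l
  have h := hB S F x 0 fun i _ => by rw [hF i x hx, norm_zero]
  rw [mul_zero] at h
  exact norm_le_zero_iff.1 h

/-- A series of Schwartz functions converges unconditionally in the Schwartz space as soon as it
converges pointwise and all its seminorms are summable. -/
theorem hasSum_schwartz {ι : Type*} {f : ι → 𝓢(E, ℂ)} {g : 𝓢(E, ℂ)}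
    (hs : ∀ k l, Summable fun i => SchwartzMap.seminorm ℂ k l (f i))
    (hp : ∀ x, HasSum (fun i => f i x) (g x)) : HasSum f g := by
  classical
  have hsum : ∀ l x, HasSum (fun i => iteratedFDeriv ℝ l (f i) x) (iteratedFDeriv ℝ l g x) := by
    intro l x
    have hg : (g : E → ℂ) = fun y => ∑' i, f i y := by
      ext y; exact (hp y).tsum_eq.symm
    have hb : ∀ (l : ℕ) (i : ι) (x : E), ‖iteratedFDeriv ℝ l (f i) x‖ ≤
        SchwartzMap.seminorm ℂ 0 l (f i) := fun l i x =>
      (f i).norm_iteratedFDeriv_le_seminorm ℂ l x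
    rw [hg, iteratedFDeriv_tsum_apply (N := ⊤) (fun i => (f i).smooth ⊤) (fun l _ => hs 0 l)
      (fun l i x _ => hb l i x) le_top]
    exact (Summable.of_norm_bounded (hs 0 l) fun i => hb l i x).hasSum
  refine ((schwartz_withSeminorms ℂ E ℂ).tendsto_nhds _ _).2 fun ⟨k, l⟩ ε hε => ?_
  obtain ⟨s₀, hs₀⟩ := (summable_iff_vanishing_norm.1 (hs k l)) (ε / 2) (by positivity)
  refine (eventually_ge_atTop s₀).mono fun s hss => ?_
  refine lt_of_le_of_lt ?_ (half_lt_self hε)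
  rw [schwartzSeminormFamily_apply]
  refine SchwartzMap.seminorm_le_bound ℂ k l _ (by positivity) fun x => ?_
  have hcoe : ∀ t : Finset ι, iteratedFDeriv ℝ l (∑ i ∈ t, f i : 𝓢(E, ℂ)) x =
      ∑ i ∈ t, iteratedFDeriv ℝ l (f i) x := fun t => by
    have h1 : ((∑ i ∈ t, f i : 𝓢(E, ℂ)) : E → ℂ) = fun y => ∑ i ∈ t, f i y := by
      ext y; simp
    rw [h1, iteratedFDeriv_fun_sum_apply fun i _ => (f i).contDiffAt l]
  -- bound the tail of the series by passing to the limit in `t` in the bounds for finite sums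
  have hlim : Tendsto (fun t : Finset ι =>
      ‖x‖ ^ k * ‖iteratedFDeriv ℝ l (∑ i ∈ s, f i - ∑ i ∈ t, f i : 𝓢(E, ℂ)) x‖) atTop
      (𝓝 (‖x‖ ^ k * ‖iteratedFDeriv ℝ l (∑ i ∈ s, f i - g : 𝓢(E, ℂ)) x‖)) := by
    have hsub : ∀ u v : 𝓢(E, ℂ), iteratedFDeriv ℝ l (u - v : 𝓢(E, ℂ)) x =
        iteratedFDeriv ℝ l u x - iteratedFDeriv ℝ l v x := fun u v => by
      have h1 : ((u - v : 𝓢(E, ℂ)) : E → ℂ) = (u : E → ℂ) - v := by ext y; simp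
      rw [h1, iteratedFDeriv_sub (u.smooth l) (v.smooth l)]
      rfl
    simp only [hsub, hcoe]
    exact ((tendsto_const_nhds.sub (hsum l x)).norm).const_mul _
  refine le_of_tendsto hlim ((eventually_ge_atTop s).mono fun t hst => ?_)
  have hts : (∑ i ∈ s, f i - ∑ i ∈ t, f i : 𝓢(E, ℂ)) = -∑ i ∈ t \ s, f i := by
    rw [← Finset.sum_sdiff hst]; abel
  refine (SchwartzMap.le_seminorm ℂ k l _ x).trans ?_
  rw [hts, map_neg_eq_map]
  refine (Finset.le_sum_of_subadditive _ (map_zero _).le (map_add_le_add _) _ _).trans ?_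
  have hdis : Disjoint (t \ s) s₀ :=
    Finset.disjoint_left.2 fun i hi hi' => (Finset.mem_sdiff.1 hi).2 (hss hi')
  have h := hs₀ (t \ s) hdis
  rw [Real.norm_eq_abs] at h
  exact (le_abs_self _).trans h.le

end MultiplierEstimates

/-! ### Convolution of square integrable functions with Schwartz functions -/

section SquareIntegrable

open scoped ENNReal

variable {E : Type*} [NormedAddCommGroup E] [InnerProductSpace ℝ E] [FiniteDimensional ℝ E]
  [MeasurableSpace E] [BorelSpace E]

/-- The convolution integral of a function with a Schwartz function. -/
noncomputable def convFun (f : E → ℂ) (φ : 𝓢(E, ℂ)) : E → ℂ :=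
  fun x => ∫ t, f t * φ (x - t)

/-- The convolution of Schwartz functions. -/
noncomputable def convSchwartz (f g : 𝓢(E, ℂ)) : 𝓢(E, ℂ) :=
  SchwartzMap.convolution (ContinuousLinearMap.mul ℂ ℂ) f g

theorem fourier_convSchwartz (f g : 𝓢(E, ℂ)) (ξ : E) :
    𝓕 (convSchwartz f g) ξ = 𝓕 f ξ * 𝓕 g ξ := by
  rw [convSchwartz, fourier_convolution]
  rfl

theorem fourier_injective {f g : 𝓢(E, ℂ)} (h : ∀ ξ, 𝓕 f ξ = 𝓕 g ξ) : f = g := by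
  have h1 : 𝓕 f = 𝓕 g := SchwartzMap.ext h
  rw [← FourierTransform.fourierInv_fourier_eq (F := 𝓢(E, ℂ)) f, h1,
    FourierTransform.fourierInv_fourier_eq]

theorem convSchwartz_assoc (f g h : 𝓢(E, ℂ)) :
    convSchwartz (convSchwartz f g) h = convSchwartz f (convSchwartz g h) :=
  fourier_injective fun ξ => by simp only [fourier_convSchwartz]; ring

theorem convFun_schwartz (f φ : 𝓢(E, ℂ)) (x : E) : convFun f φ x = convSchwartz f φ x := by
  rw [convSchwartz, SchwartzMap.convolution_apply]
  rfl

theorem eLpNorm_fourier (f : 𝓢(E, ℂ)) :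
    eLpNorm (𝓕 f : 𝓢(E, ℂ)) 2 volume = eLpNorm f 2 volume := by
  have h := norm_fourier_toL2_eq f
  rw [norm_toLp, norm_toLp] at h
  have h1 : eLpNorm (𝓕 f : 𝓢(E, ℂ)) 2 volume ≠ ⊤ :=
    (SchwartzMap.memLp (𝓕 f : 𝓢(E, ℂ)) 2 volume).eLpNorm_ne_top
  have h2 : eLpNorm f 2 volume ≠ ⊤ := (f.memLp 2 volume).eLpNorm_ne_top
  exact (ENNReal.toReal_eq_toReal_iff' h1 h2).1 h

/-- Convolution with `K` has norm at most `sup |K̂|` on `L²`, for Schwartz functions. -/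
theorem eLpNorm_convSchwartz_le {K : 𝓢(E, ℂ)} {M : ℝ} (hK : ∀ ξ, ‖𝓕 K ξ‖ ≤ M)
    (f : 𝓢(E, ℂ)) :
    eLpNorm (convSchwartz f K) 2 volume ≤ ENNReal.ofReal M * eLpNorm f 2 volume := by
  rw [← eLpNorm_fourier, ← eLpNorm_fourier f]
  refine eLpNorm_le_mul_eLpNorm_of_ae_le_mul (Eventually.of_forall fun ξ => ?_) 2
  rw [fourier_convSchwartz, norm_mul, mul_comm]
  exact mul_le_mul_of_nonneg_right (hK ξ) (norm_nonneg _)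

/-- Reflected translates of Schwartz functions are square integrable; hence the convolution integral
with a function in `L²` converges at every point. -/
theorem memLp_comp_sub_left (φ : 𝓢(E, ℂ)) (x : E) :
    MemLp (fun t => φ (x - t)) 2 volume :=
  (φ.memLp 2).comp_measurePreserving (Measure.measurePreserving_sub_left volume x)

theorem convFun_sub {f g : E → ℂ} (hf : MemLp f 2 volume) (hg : MemLp g 2 volume)
    (φ : 𝓢(E, ℂ)) : convFun (f - g) φ = convFun f φ - convFun g φ := by
  ext x
  simp only [convFun, Pi.sub_apply, sub_mul]
  exact integral_sub (hf.integrable_mul (memLp_comp_sub_left φ x))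
    (hg.integrable_mul (memLp_comp_sub_left φ x))

/-- The Cauchy-Schwarz inequality: convergence in `L²` of `f` gives convergence of `f ∗ φ` at every
point. -/
theorem enorm_convFun_le {f : E → ℂ} (hf : MemLp f 2 volume) (φ : 𝓢(E, ℂ))
    (x : E) : ‖convFun f φ x‖ₑ ≤ eLpNorm f 2 volume * eLpNorm φ 2 volume := by
  have hφ := memLp_comp_sub_left φ x
  have h := eLpNorm_smul_le_mul_eLpNorm (p := 2) (q := 2) (r := 1) hφ.aestronglyMeasurable
    hf.aestronglyMeasurable
  rw [eLpNorm_one_eq_lintegral_enorm] at h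
  have hφe : eLpNorm (fun t => φ (x - t)) 2 volume = eLpNorm φ 2 volume :=
    eLpNorm_comp_measurePreserving φ.continuous.aestronglyMeasurable
      (Measure.measurePreserving_sub_left volume x)
  rw [hφe] at h
  exact (enorm_integral_le_lintegral_enorm _).trans h

theorem exists_seq_schwartz {f : E → ℂ} (hf : MemLp f 2 volume) :
    ∃ g : ℕ → 𝓢(E, ℂ), Tendsto (fun k => eLpNorm (f - ⇑(g k)) 2 volume) atTop (𝓝 0) := by
  have h : ∀ k : ℕ, ∃ g : 𝓢(E, ℂ),
      eLpNorm (f - ⇑g) 2 volume ≤ ENNReal.ofReal (1 / (k + 1)) := fun k => by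
    obtain ⟨g, hg₁, hg₂, hg₃⟩ := hf.exist_eLpNorm_sub_le (by norm_num) (by norm_num)
      (Nat.one_div_pos_of_nat (n := k) (α := ℝ))
    exact ⟨hg₁.toSchwartzMap hg₂, hg₃⟩
  choose g hg using h
  refine ⟨g, tendsto_of_tendsto_of_tendsto_of_le_of_le tendsto_const_nhds ?_
    (fun _ => bot_le) hg⟩
  have h1 := ENNReal.tendsto_ofReal (tendsto_one_div_add_atTop_nhds_zero_nat (𝕜 := ℝ))
  simpa using h1

theorem tendsto_convSchwartz_apply {f : E → ℂ} (hf : MemLp f 2 volume)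
    {g : ℕ → 𝓢(E, ℂ)} (hg : Tendsto (fun k => eLpNorm (f - ⇑(g k)) 2 volume) atTop (𝓝 0))
    (φ : 𝓢(E, ℂ)) (x : E) :
    Tendsto (fun k => convSchwartz (g k) φ x) atTop (𝓝 (convFun f φ x)) := by
  rw [tendsto_iff_edist_tendsto_0]
  have h1 : Tendsto (fun k => eLpNorm (f - ⇑(g k)) 2 volume * eLpNorm φ 2 volume) atTop (𝓝 0) := by
    have h := ENNReal.Tendsto.mul_const hg (Or.inr (φ.memLp 2 volume).eLpNorm_ne_top)
    rwa [zero_mul] at h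
  refine tendsto_of_tendsto_of_tendsto_of_le_of_le tendsto_const_nhds h1 (fun _ => bot_le)
    fun k => ?_
  simp only
  have h2 := enorm_convFun_le (hf.sub ((g k).memLp 2 volume)) φ x
  rw [convFun_sub hf ((g k).memLp 2 volume), Pi.sub_apply, convFun_schwartz] at h2
  rwa [edist_comm, edist_eq_enorm_sub]

theorem aestronglyMeasurable_convFun {f : E → ℂ} (hf : MemLp f 2 volume)
    (φ : 𝓢(E, ℂ)) : AEStronglyMeasurable (convFun f φ) volume := by
  obtain ⟨g, hg⟩ := exists_seq_schwartz hf
  exact aestronglyMeasurable_of_tendsto_ae atTop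
    (fun k => (convSchwartz (g k) φ).continuous.aestronglyMeasurable)
    (Eventually.of_forall fun x => tendsto_convSchwartz_apply hf hg φ x)

/-- Convolution with `K` has norm at most `sup |K̂|` on `L²`; the bound passes from Schwartz
functions to all of `L²` by density and Fatou's lemma. -/
theorem eLpNorm_convFun_le {K : 𝓢(E, ℂ)} {M : ℝ} (hK : ∀ ξ, ‖𝓕 K ξ‖ ≤ M)
    {f : E → ℂ} (hf : MemLp f 2 volume) :
    eLpNorm (convFun f K) 2 volume ≤ ENNReal.ofReal M * eLpNorm f 2 volume := by
  obtain ⟨g, hg⟩ := exists_seq_schwartz hf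
  have hfatou := Lp.eLpNorm_lim_le_liminf_eLpNorm (p := 2) (μ := volume)
    (fun k => (convSchwartz (g k) K).continuous.aestronglyMeasurable) (convFun f K)
    (Eventually.of_forall fun x => tendsto_convSchwartz_apply hf hg K x)
  refine hfatou.trans ?_
  have hbound : ∀ k, eLpNorm (convSchwartz (g k) K) 2 volume ≤
      ENNReal.ofReal M * (eLpNorm f 2 volume + eLpNorm (f - ⇑(g k)) 2 volume) := fun k => by
    refine (eLpNorm_convSchwartz_le hK (g k)).trans ?_
    gcongr
    have h : (g k : E → ℂ) = f - (f - ⇑(g k)) := by simp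
    calc eLpNorm (g k) 2 volume = eLpNorm (f - (f - ⇑(g k))) 2 volume := by rw [← h]
      _ ≤ _ := eLpNorm_sub_le hf.aestronglyMeasurable
        (hf.sub ((g k).memLp 2 volume)).aestronglyMeasurable (by norm_num)
  have hlim : Tendsto (fun k => ENNReal.ofReal M * (eLpNorm f 2 volume +
      eLpNorm (f - ⇑(g k)) 2 volume)) atTop (𝓝 (ENNReal.ofReal M * eLpNorm f 2 volume)) := by
    have h := ENNReal.Tendsto.const_mul (a := ENNReal.ofReal M)
      (tendsto_const_nhds (x := eLpNorm f 2 volume) |>.add hg) (Or.inr ENNReal.ofReal_ne_top)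
    rwa [add_zero] at h
  exact (liminf_le_liminf (Eventually.of_forall hbound)).trans hlim.liminf_eq.le

theorem exists_norm_fourier_le (K : 𝓢(E, ℂ)) : ∃ M : ℝ, ∀ ξ, ‖𝓕 K ξ‖ ≤ M :=
  ⟨_, fun ξ => (𝓕 K).norm_le_seminorm ℂ ξ⟩

theorem memLp_convFun {f : E → ℂ} (hf : MemLp f 2 volume) (φ : 𝓢(E, ℂ)) :
    MemLp (convFun f φ) 2 volume := by
  obtain ⟨M, hM⟩ := exists_norm_fourier_le φ
  exact ⟨aestronglyMeasurable_convFun hf φ, (eLpNorm_convFun_le hM hf).trans_lt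
    (ENNReal.mul_lt_top ENNReal.ofReal_lt_top hf.eLpNorm_lt_top)⟩

/-- Associativity, for `f` in `L²`: it holds for Schwartz functions on the Fourier side, and both
sides are pointwise limits along a Schwartz sequence tending to `f` in `L²`. -/
theorem convFun_convFun {f : E → ℂ} (hf : MemLp f 2 volume) (φ χ : 𝓢(E, ℂ)) :
    convFun (convFun f φ) χ = convFun f (convSchwartz φ χ) := by
  ext x
  obtain ⟨g, hg⟩ := exists_seq_schwartz hf
  obtain ⟨M, hM⟩ := exists_norm_fourier_le φ
  have hg' : Tendsto (fun k => eLpNorm (convFun f φ - ⇑(convSchwartz (g k) φ)) 2 volume) atTop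
      (𝓝 0) := by
    have h1 : Tendsto (fun k => ENNReal.ofReal M * eLpNorm (f - ⇑(g k)) 2 volume) atTop (𝓝 0) := by
      have h := ENNReal.Tendsto.const_mul (a := ENNReal.ofReal M) hg
        (Or.inr ENNReal.ofReal_ne_top)
      rwa [mul_zero] at h
    refine tendsto_of_tendsto_of_tendsto_of_le_of_le tendsto_const_nhds h1 (fun _ => bot_le)
      fun k => ?_
    have h2 := eLpNorm_convFun_le hM (hf.sub ((g k).memLp 2 volume))
    rwa [convFun_sub hf ((g k).memLp 2 volume), funext (convFun_schwartz (g k) φ)] at h2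
  refine tendsto_nhds_unique (tendsto_convSchwartz_apply (memLp_convFun hf φ) hg' χ x) ?_
  simp only [convSchwartz_assoc]
  exact tendsto_convSchwartz_apply hf hg (convSchwartz φ χ) x

theorem sum_convFun {ι : Type*} {f : E → ℂ} (hf : MemLp f 2 volume) (S : Finset ι)
    (K : ι → 𝓢(E, ℂ)) (x : E) :
    ∑ j ∈ S, convFun f (K j) x = convFun f (∑ j ∈ S, K j : 𝓢(E, ℂ)) x := by
  simp only [convFun, sum_apply, Finset.mul_sum]
  exact (integral_finsetSum _ fun j _ =>
    hf.integrable_mul (memLp_comp_sub_left (K j) x)).symm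

/-- On Schwartz functions, convolutions whose Fourier multipliers are uniformly bounded and tend to
`1` almost everywhere tend to the identity in `L²`. -/
theorem tendsto_eLpNorm_sub_convSchwartz {ι : Type*} {l : Filter ι} [l.IsCountablyGenerated]
    {K : ι → 𝓢(E, ℂ)} {M : ℝ} (hK : ∀ i ξ, ‖𝓕 (K i) ξ‖ ≤ M)
    (hlim : ∀ᵐ ξ, Tendsto (fun i => 𝓕 (K i) ξ) l (𝓝 1)) (g : 𝓢(E, ℂ)) :
    Tendsto (fun i => eLpNorm (g - convSchwartz g (K i) : 𝓢(E, ℂ)) 2 volume) l (𝓝 0) := by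
  have hval : ∀ i ξ, 𝓕 (g - convSchwartz g (K i)) ξ = (1 - 𝓕 (K i) ξ) * 𝓕 g ξ := fun i ξ => by
    rw [sub_eq_add_neg, FourierTransform.fourier_add, FourierTransform.fourier_neg, add_apply,
      neg_apply, fourier_convSchwartz]
    ring
  have hrep : ∀ i, eLpNorm (g - convSchwartz g (K i) : 𝓢(E, ℂ)) 2 volume =
      (∫⁻ ξ, ‖(1 - 𝓕 (K i) ξ) * 𝓕 g ξ‖ₑ ^ (2 : ℝ)) ^ (1 / 2 : ℝ) := fun i => by
    rw [← eLpNorm_fourier, eLpNorm_eq_lintegral_rpow_enorm_toReal (by norm_num) (by norm_num)]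
    simp only [hval, ENNReal.toReal_ofNat]
  simp only [hrep]
  have hmain : Tendsto (fun i => ∫⁻ ξ, ‖(1 - 𝓕 (K i) ξ) * 𝓕 g ξ‖ₑ ^ (2 : ℝ)) l
      (𝓝 (∫⁻ _ : E, 0)) := by
    refine tendsto_lintegral_filter_of_dominated_convergence
      (fun ξ => (ENNReal.ofReal (1 + M) * ‖𝓕 g ξ‖ₑ) ^ (2 : ℝ)) (Eventually.of_forall fun i => ?_)
      (Eventually.of_forall fun i => Eventually.of_forall fun ξ => ?_) ?_ ?_
    · exact (Measurable.enorm (((continuous_const.sub (𝓕 (K i)).continuous).mul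
        (𝓕 g).continuous).measurable)).pow_const _
    · refine ENNReal.rpow_le_rpow ?_ (by norm_num)
      rw [enorm_mul]
      gcongr
      rw [← ofReal_norm]
      refine ENNReal.ofReal_le_ofReal ((norm_sub_le _ _).trans ?_)
      rw [norm_one]
      gcongr
      exact hK i ξ
    · have hmem := (𝓕 g).memLp 2 volume
      have h1 := (eLpNorm_lt_top_iff_lintegral_rpow_enorm_lt_top (p := 2) (by norm_num)
        (by norm_num)).1 hmem.eLpNorm_lt_top
      simp only [ENNReal.toReal_ofNat] at h1
      simp only [ENNReal.mul_rpow_of_nonneg _ _ (zero_le_two (α := ℝ))]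
      rw [lintegral_const_mul' _ _ (ENNReal.rpow_ne_top_of_nonneg zero_le_two
        ENNReal.ofReal_ne_top)]
      exact ENNReal.mul_ne_top (ENNReal.rpow_ne_top_of_nonneg zero_le_two ENNReal.ofReal_ne_top)
        h1.ne
    · filter_upwards [hlim] with ξ hξ
      have h1 : Tendsto (fun i => (1 - 𝓕 (K i) ξ) * 𝓕 g ξ) l (𝓝 0) := by
        have h := (hξ.const_sub 1).mul_const (𝓕 g ξ)
        rwa [sub_self, zero_mul] at h
      have h2 := (continuous_enorm.tendsto _).comp h1
      rw [enorm_zero] at h2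
      have h3 := (ENNReal.continuous_rpow_const (y := 2)).tendsto 0 |>.comp h2
      rwa [ENNReal.zero_rpow_of_pos two_pos] at h3
  rw [lintegral_zero] at hmain
  have h := (ENNReal.continuous_rpow_const (y := 1 / 2)).tendsto 0 |>.comp hmain
  rwa [ENNReal.zero_rpow_of_pos (by norm_num)] at h

/-- Convolutions whose Fourier multipliers are uniformly bounded and tend to `1` almost everywhere
tend to the identity strongly on `L²`. -/
theorem tendsto_eLpNorm_sub_convFun {ι : Type*} {l : Filter ι} [l.IsCountablyGenerated]
    {K : ι → 𝓢(E, ℂ)} {M : ℝ} (hK : ∀ i ξ, ‖𝓕 (K i) ξ‖ ≤ M)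
    (hlim : ∀ᵐ ξ, Tendsto (fun i => 𝓕 (K i) ξ) l (𝓝 1)) {f : E → ℂ}
    (hf : MemLp f 2 volume) :
    Tendsto (fun i => eLpNorm (f - convFun f (K i)) 2 volume) l (𝓝 0) := by
  rw [ENNReal.tendsto_nhds_zero]
  intro ε hε
  obtain ⟨g, hg⟩ := exists_seq_schwartz hf
  have hsmall : Tendsto (fun k => (1 + ENNReal.ofReal M) * eLpNorm (f - ⇑(g k)) 2 volume) atTop
      (𝓝 0) := by
    have h := ENNReal.Tendsto.const_mul (a := 1 + ENNReal.ofReal M) hg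
      (Or.inr (ENNReal.add_ne_top.2 ⟨ENNReal.one_ne_top, ENNReal.ofReal_ne_top⟩))
    rwa [mul_zero] at h
  have hε2 : 0 < ε / 2 := ENNReal.half_pos hε.ne'
  obtain ⟨k, hk⟩ := ((ENNReal.tendsto_nhds_zero.1 hsmall) (ε / 2) hε2).exists
  filter_upwards [(ENNReal.tendsto_nhds_zero.1 (tendsto_eLpNorm_sub_convSchwartz hK hlim (g k)))
    (ε / 2) hε2] with i hi
  have hgk := (g k).memLp 2 volume
  have hfg := hf.sub hgk
  -- compare `f` with a Schwartz function `g k` close to it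
  have hdec : f - convFun f (K i) = ((f - ⇑(g k)) - convFun (f - ⇑(g k)) (K i)) +
      (g k - convSchwartz (g k) (K i) : 𝓢(E, ℂ)) := by
    rw [convFun_sub hf hgk]
    ext x
    simp only [Pi.sub_apply, Pi.add_apply, sub_apply, convFun_schwartz]
    ring
  calc eLpNorm (f - convFun f (K i)) 2 volume
      ≤ eLpNorm ((f - ⇑(g k)) - convFun (f - ⇑(g k)) (K i)) 2 volume +
        eLpNorm (g k - convSchwartz (g k) (K i) : 𝓢(E, ℂ)) 2 volume := by
        rw [hdec]
        exact eLpNorm_add_le (hfg.sub (memLp_convFun hfg _)).aestronglyMeasurable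
          ((g k - convSchwartz (g k) (K i) : 𝓢(E, ℂ)).continuous.aestronglyMeasurable)
          (by norm_num)
    _ ≤ (eLpNorm (f - ⇑(g k)) 2 volume + ENNReal.ofReal M * eLpNorm (f - ⇑(g k)) 2 volume) +
        ε / 2 := by
        gcongr
        refine (eLpNorm_sub_le hfg.aestronglyMeasurable
          (memLp_convFun hfg _).aestronglyMeasurable (by norm_num)).trans ?_
        gcongr
        exact eLpNorm_convFun_le (hK i) hfg
    _ = (1 + ENNReal.ofReal M) * eLpNorm (f - ⇑(g k)) 2 volume + ε / 2 := by ring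
    _ ≤ ε / 2 + ε / 2 := by gcongr
    _ = ε := ENNReal.add_halves ε

end SquareIntegrable

/-! ### Dilations, tensor products and the Fourier transform -/

section Dilations

variable {n m : ℕ}

theorem inner_equiv_apply (A : Dilation n) (x y : Rn n) :
    inner ℝ (A.equiv x) y = inner ℝ x (A.transpose.equiv y) := by
  rw [A.equiv_apply, A.transpose.equiv_apply, EuclideanSpace.inner_eq_star_dotProduct,
    EuclideanSpace.inner_eq_star_dotProduct]
  simp only [star_trivial]
  change y.ofLp ⬝ᵥ A.mat.mulVec x.ofLp = A.mat.transpose.mulVec y.ofLp ⬝ᵥ x.ofLp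
  rw [Matrix.dotProduct_mulVec, Matrix.mulVec_transpose]

theorem inner_equiv_zpow_apply (A : Dilation n) (k : ℤ) (x y : Rn n) :
    inner ℝ ((A.equiv ^ k) x) y = inner ℝ x ((A.transpose.equiv ^ k) y) := by
  have hinv : ∀ x y : Rn n, inner ℝ ((A.equiv⁻¹) x) y = inner ℝ x ((A.transpose.equiv⁻¹) y) := by
    intro x y
    have h := inner_equiv_apply A (A.equiv⁻¹ x) (A.transpose.equiv⁻¹ y)
    rw [show A.equiv (A.equiv⁻¹ x) = x from A.equiv.apply_symm_apply x,
      show A.transpose.equiv (A.transpose.equiv⁻¹ y) = y from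
        A.transpose.equiv.apply_symm_apply y] at h
    exact h.symm
  induction k generalizing x y with
  | zero => simp only [zpow_zero]; rfl
  | succ k ih =>
    rw [zpow_add_one, add_comm, zpow_add, zpow_one]
    exact (ih _ _).trans (inner_equiv_apply A _ _)
  | pred k ih =>
    rw [zpow_sub_one, sub_eq_add_neg, add_comm, zpow_add, zpow_neg_one]
    exact (ih _ _).trans (hinv _ _)

/-- The unit ball makes `A⁻¹` a strict contraction for the norm whose unit ball it is, so the
powers of `A`, and of its transpose by duality, expand geometrically. -/
theorem Dilation.IsUnitBall.exists_expands {A : Dilation n} {Δ : Set (Rn n)}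
    (hΔ : A.IsUnitBall Δ) : ∃ C ρ : ℝ, Expands A.transpose.equiv C ρ := by
  obtain ⟨⟨L, rfl⟩, -, r, hr, -, hrA⟩ := hΔ
  -- `‖L.symm x‖` is the norm of `x` with unit ball `Δ`
  have hr0 : 0 < r := one_pos.trans hr
  have hmem : ∀ x, ‖L.symm x‖ < 1 → r * ‖L.symm (A.equiv.symm x)‖ < 1 := by
    intro x hx
    obtain ⟨y, ⟨z, hz, rfl⟩, hy⟩ := hrA ⟨x, ⟨L.symm x, by simpa using hx, by simp⟩, rfl⟩
    have hxz : r • L.symm (A.equiv.symm x) = z := by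
      have h : A.equiv.symm (r • x) = L z := by
        rw [A.equiv.symm_apply_eq]; exact hy.symm
      rw [← map_smul, ← map_smul, h, L.symm_apply_apply]
    have h1 : ‖r • L.symm (A.equiv.symm x)‖ < 1 := by
      rw [hxz]; simpa using hz
    rwa [norm_smul, Real.norm_of_nonneg hr0.le] at h1
  have hcontr : ∀ x, ‖L.symm (A.equiv.symm x)‖ ≤ r⁻¹ * ‖L.symm x‖ := by
    intro x
    rw [← div_eq_inv_mul, le_div_iff₀' hr0]
    refine le_of_forall_gt_imp_ge_of_dense fun c hc => ?_
    have hc0 : 0 < c := (norm_nonneg _).trans_lt hc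
    have h := hmem (c⁻¹ • x) (by
      rw [map_smul, norm_smul, Real.norm_of_nonneg (by positivity), inv_mul_lt_one₀ hc0]
      exact hc)
    rw [map_smul, map_smul, norm_smul, Real.norm_of_nonneg (by positivity : 0 ≤ c⁻¹)] at h
    have : r * (c⁻¹ * ‖L.symm (A.equiv.symm x)‖) = c⁻¹ * (r * ‖L.symm (A.equiv.symm x)‖) := by ring
    rw [this, inv_mul_lt_one₀ hc0] at h
    exact h.le
  have hiter : ∀ (k : ℕ) x, ‖L.symm ((A.equiv⁻¹ ^ k) x)‖ ≤ r⁻¹ ^ k * ‖L.symm x‖ := by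
    intro k
    induction k with
    | zero => intro x; simp only [pow_zero, one_mul]; exact le_rfl
    | succ k ih =>
      intro x
      rw [pow_succ]
      refine (ih (A.equiv⁻¹ x)).trans ?_
      rw [pow_succ, mul_assoc]
      exact mul_le_mul_of_nonneg_left (hcontr x) (by positivity)
  set C := ‖(L : Rn n →L[ℝ] Rn n)‖ * ‖(L.symm : Rn n →L[ℝ] Rn n)‖ + 1
  have hpow : ∀ (k : ℕ) x, ‖(A.equiv⁻¹ ^ k) x‖ ≤ C * r⁻¹ ^ k * ‖x‖ := by
    intro k x
    calc ‖(A.equiv⁻¹ ^ k) x‖ = ‖(L : Rn n →L[ℝ] Rn n) (L.symm ((A.equiv⁻¹ ^ k) x))‖ := by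
          rw [ContinuousLinearEquiv.coe_coe, L.apply_symm_apply]
      _ ≤ ‖(L : Rn n →L[ℝ] Rn n)‖ * (r⁻¹ ^ k * (‖(L.symm : Rn n →L[ℝ] Rn n)‖ * ‖x‖)) := by
          refine (ContinuousLinearMap.le_opNorm _ _).trans ?_
          gcongr
          refine (hiter k x).trans ?_
          gcongr
          exact (L.symm : Rn n →L[ℝ] Rn n).le_opNorm x
      _ = (‖(L : Rn n →L[ℝ] Rn n)‖ * ‖(L.symm : Rn n →L[ℝ] Rn n)‖) * r⁻¹ ^ k * ‖x‖ := by ring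
      _ ≤ _ := by
          gcongr
          exact (lt_add_one _).le
  refine ⟨C, r⁻¹, by positivity, by positivity, inv_lt_one_of_one_lt₀ hr, fun k v => ?_⟩
  rcases eq_or_ne v 0 with rfl | hv
  · simp
  have hv0 : 0 < ‖v‖ := norm_pos_iff.2 hv
  have h1 : ‖v‖ * ‖v‖ = inner ℝ ((A.equiv⁻¹ ^ k) v) ((A.transpose.equiv ^ k) v) := by
    have h := inner_equiv_zpow_apply A k ((A.equiv⁻¹ ^ k) v) v
    rw [zpow_natCast, zpow_natCast] at h
    rw [← h, inv_pow]
    rw [show (A.equiv ^ k) ((A.equiv ^ k)⁻¹ v) = v from (A.equiv ^ k).apply_symm_apply v,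
      real_inner_self_eq_norm_mul_norm]
  have h2 : ‖v‖ * ‖v‖ ≤ ‖v‖ * (C * r⁻¹ ^ k * ‖(A.transpose.equiv ^ k) v‖) := by
    rw [h1]
    refine (real_inner_le_norm _ _).trans ?_
    calc _ ≤ C * r⁻¹ ^ k * ‖v‖ * ‖(A.transpose.equiv ^ k) v‖ := by
          gcongr; exact hpow k v
      _ = _ := by ring
  exact le_of_mul_le_mul_left h2 hv0

theorem Dilation.b_pos (A : Dilation n) : 0 < A.b := by
  rw [Dilation.b, abs_pos]
  exact ((Matrix.isUnit_iff_isUnit_det _).1 A.isUnit_mat).ne_zero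

theorem integral_comp_equiv (A : Dilation n) (g : Rn n → ℂ) :
    ∫ x, g (A.equiv x) = (A.b⁻¹ : ℝ) • ∫ x, g x := by
  have hdet : LinearMap.det (A.equiv : Rn n →ₗ[ℝ] Rn n) = A.mat.det := by
    have h : (A.equiv : Rn n →ₗ[ℝ] Rn n) = Matrix.toEuclideanLin A.mat := by
      ext x; rfl
    rw [h, Matrix.toEuclideanLin, Matrix.toLpLin_eq_toLin, LinearMap.det_toLin]
  have hne : LinearMap.det (A.equiv : Rn n →ₗ[ℝ] Rn n) ≠ 0 := by
    rw [hdet]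
    exact ((Matrix.isUnit_iff_isUnit_det _).1 A.isUnit_mat).ne_zero
  have hmap := Measure.map_linearMap_addHaar_eq_smul_addHaar (volume : Measure (Rn n)) hne
  have h := (A.equiv.toHomeomorph.measurableEmbedding).integral_map
    (μ := (volume : Measure (Rn n))) g
  have hcoe : ((A.equiv : Rn n →ₗ[ℝ] Rn n) : Rn n → Rn n) = A.equiv.toHomeomorph := rfl
  rw [hcoe] at hmap
  rw [hmap, integral_smul_measure, ENNReal.toReal_ofReal (abs_nonneg _), hdet, abs_inv] at h
  exact h.symm

theorem integral_comp_equiv_zpow (A : Dilation n) (k : ℤ) (g : Rn n → ℂ) :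
    ∫ x, g ((A.equiv ^ k) x) = (A.b ^ (-k) : ℝ) • ∫ x, g x := by
  have hb := A.b_pos.ne'
  induction k generalizing g with
  | zero => simp only [zpow_zero, neg_zero, one_smul]; rfl
  | succ k ih =>
    have h := integral_comp_equiv A fun x => g ((A.equiv ^ (k : ℤ)) x)
    rw [ih, smul_smul] at h
    rw [zpow_add_one, neg_add, zpow_add₀ hb, zpow_neg_one, mul_comm]
    exact h
  | pred k ih =>
    have h := integral_comp_equiv A fun x => g ((A.equiv ^ (-(k : ℤ) - 1)) x)
    have h2 := ih g
    have h3 : ∀ x, (A.equiv ^ (-(k : ℤ) - 1)) (A.equiv x) = (A.equiv ^ (-(k : ℤ))) x := fun x => by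
      conv_rhs => rw [show -(k : ℤ) = -(k : ℤ) - 1 + 1 by ring, zpow_add_one]
      rfl
    simp only [h3] at h
    rw [h2] at h
    rw [show -(-(k : ℤ) - 1) = 1 + - -(k : ℤ) by ring, zpow_add₀ hb, zpow_one, mul_smul, h,
      smul_smul, mul_inv_cancel₀ hb, one_smul]

/-- The one-parameter dilate `x ↦ b ^ (-k) φ (A ^ (-k) x)`. -/
noncomputable def dilateOne (A : Dilation n) (k : ℤ) (φ : 𝓢(Rn n, ℂ)) : 𝓢(Rn n, ℂ) :=
  ((A.b ^ (-k) : ℝ) : ℂ) • compCLMOfContinuousLinearEquiv ℂ (A.equiv ^ (-k)) φ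

theorem dilateOne_apply (A : Dilation n) (k : ℤ) (φ : 𝓢(Rn n, ℂ)) (x : Rn n) :
    dilateOne A k φ x = ((A.b ^ (-k) : ℝ) : ℂ) * φ ((A.equiv ^ (-k)) x) := rfl

theorem dilate_tensor (A₁ : Dilation n) (A₂ : Dilation m) (k₁ k₂ : ℤ) (φ₁ : 𝓢(Rn n, ℂ))
    (φ₂ : 𝓢(Rn m, ℂ)) :
    dilate A₁ A₂ k₁ k₂ (tensor φ₁ φ₂) = tensor (dilateOne A₁ k₁ φ₁) (dilateOne A₂ k₂ φ₂) := by
  ext x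
  rw [dilate_apply, tensor_apply, tensor_apply, dilateOne_apply, dilateOne_apply]
  push_cast
  exact mul_mul_mul_comm _ _ _ _

/-- The normalisation by `b ^ (-k)` cancels the Jacobian of `x ↦ A ^ k x`. -/
theorem fourier_dilateOne (A : Dilation n) (k : ℤ) (φ : 𝓢(Rn n, ℂ)) (ξ : Rn n) :
    𝓕 (dilateOne A k φ) ξ = 𝓕 φ ((A.transpose.equiv ^ k) ξ) := by
  rw [fourier_coe, fourier_coe, Real.fourier_eq, Real.fourier_eq]
  have h := integral_comp_equiv_zpow A k fun x =>
    Real.fourierChar (-inner ℝ x ξ) • dilateOne A k φ x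
  have hb : (A.b ^ (-k) : ℝ) ≠ 0 := (zpow_pos A.b_pos _).ne'
  refine smul_right_injective ℂ hb ?_
  simp only
  rw [← h, ← integral_smul]
  refine integral_congr_ae (Eventually.of_forall fun x => ?_)
  simp only [inner_equiv_zpow_apply, dilateOne_apply]
  have hx : (A.equiv ^ (-k)) ((A.equiv ^ k) x) = x := by
    rw [zpow_neg]; exact (A.equiv ^ k).symm_apply_apply x
  rw [hx, Complex.real_smul, Circle.smul_def, Circle.smul_def, smul_eq_mul, smul_eq_mul]
  ring

theorem integral_RnRm (g : RnRm n m → ℂ) :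
    ∫ x, g x = ∫ p : Rn n × Rn m, g (WithLp.toLp 2 p) :=
  ((WithLp.volume_preserving_toLp (Rn n) (Rn m)).integral_comp
    (WithLp.prodContinuousLinearEquiv 2 ℝ (Rn n) (Rn m)).symm.toHomeomorph.measurableEmbedding
    g).symm

theorem fourier_tensor (φ₁ : 𝓢(Rn n, ℂ)) (φ₂ : 𝓢(Rn m, ℂ)) :
    𝓕 (tensor φ₁ φ₂) = tensor (𝓕 φ₁) (𝓕 φ₂) := by
  ext ξ
  rw [tensor_apply, fourier_coe, fourier_coe, fourier_coe, Real.fourier_eq, Real.fourier_eq,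
    Real.fourier_eq, integral_RnRm, ← integral_prod_mul]
  refine integral_congr_ae (Eventually.of_forall fun p => ?_)
  simp only [tensor_apply, WithLp.prod_inner_apply, Circle.smul_def, smul_eq_mul]
  rw [neg_add, AddChar.map_add_eq_mul, Circle.coe_mul]
  exact mul_mul_mul_comm _ _ _ _

theorem fourier_convS (f g : 𝓢(RnRm n m, ℂ)) (ξ : RnRm n m) :
    𝓕 (convS f g) ξ = 𝓕 f ξ * 𝓕 g ξ := by
  rw [convS, fourier_convolution]
  rfl

theorem convS_assoc (f g h : 𝓢(RnRm n m, ℂ)) : convS (convS f g) h = convS f (convS g h) :=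
  fourier_injective fun ξ => by simp only [fourier_convS]; ring

/-- The projection `(x₁, x₂) ↦ (0, x₂)` is complementary to the first coordinate. -/
theorem isComplProj_fst : IsComplProj (WithLp.fstL 2 ℝ (Rn n) (Rn m))
    (ContinuousLinearMap.id ℝ _ -
      ((WithLp.prodContinuousLinearEquiv 2 ℝ (Rn n) (Rn m)).symm : Rn n × Rn m →L[ℝ] RnRm n m) ∘L
      ContinuousLinearMap.inl ℝ _ _ ∘L WithLp.fstL 2 ℝ (Rn n) (Rn m)) where
  norm_le x := WithLp.norm_fst_le _ x
  map_proj x := by simp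
  proj_proj x := by simp
  norm_proj_le x := by
    rw [WithLp.prod_norm_eq_of_L2, WithLp.prod_norm_eq_of_L2]
    refine Real.sqrt_le_sqrt ?_
    simp
  norm_sub_le x := by
    rw [WithLp.prod_norm_eq_of_L2]
    simp

/-- The projection `(x₁, x₂) ↦ (x₁, 0)` is complementary to the second coordinate. -/
theorem isComplProj_snd : IsComplProj (WithLp.sndL 2 ℝ (Rn n) (Rn m))
    (ContinuousLinearMap.id ℝ _ -
      ((WithLp.prodContinuousLinearEquiv 2 ℝ (Rn n) (Rn m)).symm : Rn n × Rn m →L[ℝ] RnRm n m) ∘L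
      ContinuousLinearMap.inr ℝ _ _ ∘L WithLp.sndL 2 ℝ (Rn n) (Rn m)) where
  norm_le x := WithLp.norm_snd_le _ x
  map_proj x := by simp
  proj_proj x := by simp
  norm_proj_le x := by
    rw [WithLp.prod_norm_eq_of_L2, WithLp.prod_norm_eq_of_L2]
    refine Real.sqrt_le_sqrt ?_
    simp
  norm_sub_le x := by
    rw [WithLp.prod_norm_eq_of_L2]
    simp

end Dilations

/-! ### Annular resolutions of the identity -/

section AnnularResolution

open scoped ContDiff

variable {V : Type*} [NormedAddCommGroup V] [NormedSpace ℝ V]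

/-- A smooth function `g`, supported in the annulus `δ ≤ ‖v‖ ≤ b`, whose dilates by the powers of
the expansive map `T` sum to `1` off the origin. -/
structure IsAnnularResolution (T : V ≃L[ℝ] V) (g : V → ℂ) (C ρ δ b : ℝ) : Prop where
  expands : Expands T C ρ
  boundedDerivs : BoundedDerivs g
  inner_pos : 0 < δ
  outer_nonneg : 0 ≤ b
  norm_mem : ∀ v ∈ tsupport g, δ ≤ ‖v‖ ∧ ‖v‖ ≤ b
  hasSum : ∀ v, v ≠ 0 → HasSum (fun j : ℤ => g ((T ^ j) v)) 1

variable {T : V ≃L[ℝ] V} {g : V → ℂ} {C ρ δ b : ℝ}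

namespace IsAnnularResolution

theorem eq_zero_of_lt (h : IsAnnularResolution T g C ρ δ b) {v : V} (hv : ‖v‖ < δ) : g v = 0 :=
  image_eq_zero_of_notMem_tsupport fun hm => absurd (h.norm_mem v hm).1 (not_le.2 hv)

theorem eq_zero_of_gt (h : IsAnnularResolution T g C ρ δ b) {v : V} (hv : b < ‖v‖) : g v = 0 :=
  image_eq_zero_of_notMem_tsupport fun hm => absurd (h.norm_mem v hm).2 (not_le.2 hv)

theorem map_zero (h : IsAnnularResolution T g C ρ δ b) : g 0 = 0 :=
  h.eq_zero_of_lt (by rw [norm_zero]; exact h.inner_pos)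

theorem exists_mul_pow_lt (h : IsAnnularResolution T g C ρ δ b) {ε : ℝ} (hε : 0 < ε) :
    ∃ J : ℕ, ∀ j, J ≤ j → C * ρ ^ j * b < ε := by
  have h1 := ((tendsto_pow_atTop_nhds_zero_of_lt_one h.expands.rate_pos.le
    h.expands.rate_lt_one).const_mul C).mul_const b
  rw [mul_zero, zero_mul] at h1
  exact eventually_atTop.1 (h1.eventually (gt_mem_nhds hε))

/-- An orbit of `T` meets the annulus a bounded number of times, so the dilates of `g` are
absolutely summable with a uniform bound. -/
theorem exists_sum_norm_le (h : IsAnnularResolution T g C ρ δ b) :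
    ∃ M : ℝ, 0 ≤ M ∧ ∀ (v : V) (S : Finset ℤ), ∑ j ∈ S, ‖g ((T ^ j) v)‖ ≤ M := by
  obtain ⟨B, hB⟩ := h.boundedDerivs.bound 0
  simp only [norm_iteratedFDeriv_zero] at hB
  have hB0 : 0 ≤ B := (norm_nonneg _).trans (hB 0)
  obtain ⟨D, hD⟩ := h.exists_mul_pow_lt h.inner_pos
  refine ⟨D * B, by positivity, fun v S => ?_⟩
  -- two visits of an orbit to the annulus are fewer than `D` steps apart, by expansion
  have hsep : ∀ i j : ℤ, g ((T ^ i) v) ≠ 0 → g ((T ^ j) v) ≠ 0 → j < i + D := by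
    intro i j hi hj
    by_contra! hij
    obtain ⟨e, rfl⟩ : ∃ e : ℕ, j = i + e := ⟨(j - i).toNat, by lia⟩
    have h1 : δ ≤ ‖(T ^ i) v‖ := not_lt.1 fun hlt => hi (h.eq_zero_of_lt hlt)
    have h2 : ‖(T ^ (i + e)) v‖ ≤ b := not_lt.1 fun hlt => hj (h.eq_zero_of_gt hlt)
    have h3 := h.expands.norm_zpow_le i e v
    have h4 := hD e (by lia)
    have hC := h.expands.const_pos
    have hρ := h.expands.rate_pos
    have h5 : C * ρ ^ e * ‖(T ^ (i + e)) v‖ ≤ C * ρ ^ e * b := by gcongr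
    linarith
  rw [← Finset.sum_filter_ne_zero]
  set S' := S.filter fun j => ‖g ((T ^ j) v)‖ ≠ 0
  have hS' : ∀ j ∈ S', g ((T ^ j) v) ≠ 0 := fun j hj =>
    norm_ne_zero_iff.1 (Finset.mem_filter.1 hj).2
  have hcard : S'.card ≤ D := by
    rcases S'.eq_empty_or_nonempty with he | hne
    · simp [he]
    have hsub : S' ⊆ Finset.Ico (S'.min' hne) (S'.min' hne + D) := fun j hj =>
      Finset.mem_Ico.2 ⟨S'.min'_le j hj, hsep _ _ (hS' _ (S'.min'_mem hne)) (hS' _ hj)⟩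
    simpa using Finset.card_le_card hsub
  calc ∑ j ∈ S', ‖g ((T ^ j) v)‖ ≤ S'.card • B := Finset.sum_le_card_nsmul _ _ _ fun j _ => hB _
    _ ≤ D * B := by
      rw [nsmul_eq_mul]
      gcongr

theorem hasSum_range (h : IsAnnularResolution T g C ρ δ b) {ε : ℝ} {J : ℕ}
    (hJ : ∀ j, J ≤ j → C * ρ ^ j * b < ε) {v : V} (hv : ε ≤ ‖v‖) :
    HasSum (fun j : ℕ => g ((T ^ j) v)) (∑ j ∈ Finset.range J, g ((T ^ j) v)) := by
  refine hasSum_sum_of_ne_finset_zero fun j hj => h.eq_zero_of_gt ?_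
  have h1 := h.expands.norm_le j v
  have h2 := hJ j (by simpa using hj)
  have hC := h.expands.const_pos
  have hρ := h.expands.rate_pos
  have h3 : 0 < C * ρ ^ j := by positivity
  by_contra! h4
  have h5 : C * ρ ^ j * ‖(T ^ j) v‖ ≤ C * ρ ^ j * b := by gcongr
  linarith

/-- The sum of the nonnegative dilates of an annular resolution extends to a test function `φ` which
is `1` near the origin, and `g` is the difference of `φ` and its dilate. -/
theorem exists_lowPass [FiniteDimensional ℝ V] (h : IsAnnularResolution T g C ρ δ b) :
    ∃ φ : 𝓢(V, ℂ), (∀ v, φ v - φ (T v) = g v) ∧ ∃ ε : ℝ, 0 < ε ∧ ∀ v, ‖v‖ < ε → φ v = 1 := by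
  classical
  have hC := h.expands.const_pos
  have hρ := h.expands.rate_pos
  -- the value at the origin, where the series is identically `0`, is the limit `1`
  set Φ : V → ℂ := fun v => if v = 0 then 1 else ∑' j : ℕ, g ((T ^ j) v)
  have hΦ0 : Φ 0 = 1 := if_pos rfl
  have hΦne : ∀ v, v ≠ 0 → Φ v = ∑' j : ℕ, g ((T ^ j) v) := fun v hv => if_neg hv
  have hfar : ∀ ε : ℝ, 0 < ε → ∃ J : ℕ, ∀ v, ε ≤ ‖v‖ →
      HasSum (fun j : ℕ => g ((T ^ j) v)) (∑ j ∈ Finset.range J, g ((T ^ j) v)) := fun ε hε => by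
    obtain ⟨J, hJ⟩ := h.exists_mul_pow_lt hε
    exact ⟨J, fun v hv => h.hasSum_range hJ hv⟩
  have hone : ∀ v, ‖v‖ < δ / C → Φ v = 1 := by
    intro v hv
    rcases eq_or_ne v 0 with rfl | hv0
    · exact hΦ0
    rw [hΦne v hv0]
    refine HasSum.tsum_eq ?_
    have hs := h.hasSum v hv0
    rw [← (Nat.cast_injective (R := ℤ)).hasSum_iff] at hs
    · simpa only [Function.comp_def, zpow_natCast] using hs
    · intro j hj
      have hj0 : j < 0 := not_le.1 fun h0 => hj ⟨j.toNat, by simp [h0]⟩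
      obtain ⟨n, rfl⟩ : ∃ n : ℕ, j = -n := ⟨(-j).toNat, by lia⟩
      refine h.eq_zero_of_lt ?_
      have h1 := h.expands.norm_zpow_le (-n) n v
      rw [neg_add_cancel, zpow_zero] at h1
      refine h1.trans_lt ?_
      have hρn : ρ ^ n ≤ 1 := pow_le_one₀ hρ.le h.expands.rate_lt_one.le
      calc C * ρ ^ n * ‖v‖ ≤ C * 1 * ‖v‖ := by gcongr
        _ < δ := by rw [mul_one, mul_comm]; exact (lt_div_iff₀ hC).1 hv
  have hcompact : HasCompactSupport Φ := by
    refine HasCompactSupport.intro (isCompact_closedBall 0 (C * b)) fun v hv => ?_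
    have hv1 : C * b < ‖v‖ := by simpa using hv
    have hv0 : v ≠ 0 := by
      rintro rfl
      rw [norm_zero] at hv1
      exact absurd hv1 (not_lt.2 (mul_nonneg hC.le h.outer_nonneg))
    rw [hΦne v hv0]
    refine (h.hasSum_range (J := 0) (ε := ‖v‖) (fun j _ => ?_) le_rfl).tsum_eq
    have hρn : ρ ^ j ≤ 1 := pow_le_one₀ hρ.le h.expands.rate_lt_one.le
    refine lt_of_le_of_lt ?_ hv1
    have := h.outer_nonneg
    calc C * ρ ^ j * b ≤ C * 1 * b := by gcongr
      _ = C * b := by ring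
  have hsmooth : ContDiff ℝ ∞ Φ := by
    refine contDiff_iff_contDiffAt.2 fun v => ?_
    rcases eq_or_ne v 0 with rfl | hv
    · have he : Φ =ᶠ[𝓝 0] fun _ => 1 := by
        filter_upwards [Metric.ball_mem_nhds (0 : V) (div_pos h.inner_pos hC)] with w hw
        exact hone w (by simpa using hw)
      exact contDiffAt_const.congr_of_eventuallyEq he
    · obtain ⟨J, hJ⟩ := hfar (‖v‖ / 2) (by positivity)
      have he : Φ =ᶠ[𝓝 v] fun w => ∑ j ∈ Finset.range J, g ((T ^ j) w) := by
        have : ∀ᶠ w in 𝓝 v, ‖v‖ / 2 < ‖w‖ :=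
          continuous_norm.continuousAt.eventually
            (lt_mem_nhds (half_lt_self (norm_pos_iff.2 hv)))
        filter_upwards [this] with w hw
        have hw0 : w ≠ 0 := by
          rintro rfl
          rw [norm_zero] at hw
          exact absurd hw (not_lt.2 (by positivity))
        rw [hΦne w hw0]
        exact (hJ w hw.le).tsum_eq
      refine ContDiffAt.congr_of_eventuallyEq ?_ he
      exact (ContDiff.sum fun j _ =>
        h.boundedDerivs.contDiff.comp (T ^ j : V ≃L[ℝ] V).contDiff).contDiffAt
  refine ⟨hcompact.toSchwartzMap hsmooth, fun v => ?_, δ / C, div_pos h.inner_pos hC, hone⟩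
  change Φ v - Φ (T v) = g v
  rcases eq_or_ne v 0 with rfl | hv
  · rw [_root_.map_zero, sub_self, h.map_zero]
  have hTv : T v ≠ 0 := by simpa using hv
  obtain ⟨J, hJ⟩ := hfar ‖v‖ (norm_pos_iff.2 hv)
  rw [hΦne v hv, hΦne _ hTv, (hJ v le_rfl).summable.tsum_eq_zero_add]
  simp only [pow_succ, pow_zero]
  exact add_sub_cancel_right _ _

end IsAnnularResolution

theorem sum_Icc_dilates_eq {φ g : V → ℂ} (hφ : ∀ v, φ v - φ (T v) = g v) {M N : ℤ} (hMN : M ≤ N)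
    (v : V) : ∑ j ∈ Finset.Icc M N, g ((T ^ j) v) = φ ((T ^ M) v) - φ ((T ^ (N + 1)) v) := by
  have hstep : ∀ j : ℤ, g ((T ^ j) v) = φ ((T ^ j) v) - φ ((T ^ (j + 1)) v) := fun j => by
    rw [← hφ, add_comm, zpow_add, zpow_one]
    rfl
  induction N, hMN using Int.leInduction with
  | base => rw [Finset.Icc_self, Finset.sum_singleton, hstep]
  | succ N hMN ih =>
    have hI : Finset.Icc M (N + 1) = insert (N + 1) (Finset.Icc M N) := by
      ext j
      simp only [Finset.mem_Icc, Finset.mem_insert]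
      lia
    rw [hI, Finset.sum_insert (by simp), ih, hstep]
    ring

end AnnularResolution

/-- The product `ψ̂ θ̂` is supported in an annulus because `ψ̂` is. -/
theorem IsCalderonPair.exists_isAnnularResolution {n : ℕ} {A : Dilation n} {Δ : Set (Rn n)} {s : ℕ}
    {θ ψ : 𝓢(Rn n, ℂ)} (h : IsCalderonPair A Δ s θ ψ) (hΔ : A.IsUnitBall Δ) :
    ∃ C ρ δ b : ℝ,
      IsAnnularResolution A.transpose.equiv (fun ξ => 𝓕 ψ ξ * 𝓕 θ ξ) C ρ δ b := by
  obtain ⟨C, ρ, hT⟩ := hΔ.exists_expands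
  obtain ⟨b, hb⟩ := h.compact_support.isCompact.isBounded.exists_norm_le
  obtain ⟨δ, hδ, hδ'⟩ := Metric.isOpen_iff.1 (isClosed_tsupport _).isOpen_compl 0 h.away_from_zero
  have hsub : tsupport (fun ξ => 𝓕 ψ ξ * 𝓕 θ ξ) ⊆ tsupport (𝓕 ψ : 𝓢(Rn n, ℂ)) :=
    tsupport_mul_subset_left
  refine ⟨C, ρ, δ, max b 0, hT, ?_, hδ, le_max_right _ _, fun v hv => ⟨?_, ?_⟩, h.resolution⟩
  · exact BoundedDerivs.of_schwartz (pairing (ContinuousLinearMap.mul ℂ ℂ) (𝓕 ψ) (𝓕 θ))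
  · by_contra! hlt
    exact hδ' (mem_ball_zero_iff.2 hlt) (hsub hv)
  · exact (hb v (hsub hv)).trans (le_max_left _ _)

/-! ### Vanishing moments and flatness of the Fourier transform -/

section VanishingMoments

open scoped LineDeriv

/-- If a class of Schwartz functions is stable under multiplication by linear forms and the Fourier
transforms of its members vanish on `P x = 0`, then these vanish there to infinite order. -/
theorem flatOn_fourier {E V : Type*} [NormedAddCommGroup E] [InnerProductSpace ℝ E]
    [FiniteDimensional ℝ E] [MeasurableSpace E] [BorelSpace E] [NormedAddCommGroup V]
    [NormedSpace ℝ V] {P : E →L[ℝ] V} {W : Set 𝓢(E, ℂ)}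
    (hmul : ∀ f ∈ W, ∀ v : E, smulLeftCLM ℂ (inner ℝ · v) f ∈ W)
    (hzero : ∀ f ∈ W, ∀ x, P x = 0 → 𝓕 f x = 0) {f : 𝓢(E, ℂ)} (hf : f ∈ W) :
    FlatOn P (𝓕 f) := by
  intro l x hx
  ext v
  rw [← iteratedLineDerivOp_eq_iteratedFDeriv]
  change (∂^{v} (𝓕 f)) x = 0
  induction l generalizing f with
  | zero => exact hzero f hf x hx
  | succ l ih =>
    rw [LineDeriv.iteratedLineDerivOp_succ_right, lineDerivOp_fourier_eq,
      FourierTransform.fourier_smul, LineDeriv.iteratedLineDerivOp_smul, smul_apply,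
      ih (hmul f hf _), smul_zero]

variable {d : ℕ} {E : Type*} [NormedAddCommGroup E] [InnerProductSpace ℝ E]

/-- The Schwartz functions on `E` with vanishing moments of all orders along the translates `a + ι
ℝᵈ`, for `a` in the kernel of `P`. One definition serves both factors of `ℝⁿ × ℝᵐ`: `ι` is the
inclusion of a factor and `P` the projection to it. -/
def momentClass (ι : Rn d →L[ℝ] E) (P : E →L[ℝ] Rn d) : Set 𝓢(E, ℂ) :=
  {f | ∀ (γ : Fin d → ℕ) (a : E), P a = 0 →
    ∫ u : Rn d, f (ι u + a) * ((∏ i, u i ^ γ i : ℝ) : ℂ) = 0}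

theorem integrable_slice_mul_monomial {ι : Rn d →L[ℝ] E} (hι : ∀ u, ‖ι u‖ = ‖u‖) (a : E)
    (f : 𝓢(E, ℂ)) (γ : Fin d → ℕ) :
    Integrable fun u : Rn d => f (ι u + a) * ((∏ i, u i ^ γ i : ℝ) : ℂ) := by
  have hg : (fun u : Rn d => ι u + a).HasTemperateGrowth :=
    ι.hasTemperateGrowth.add (Function.HasTemperateGrowth.const a)
  set F : 𝓢(Rn d, ℂ) := compCLM ℂ hg ⟨1, 1 + ‖a‖, fun u => by
    have h1 : ‖u‖ ≤ ‖ι u + a‖ + ‖a‖ := by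
      rw [← hι u]
      calc ‖ι u‖ = ‖ι u + a - a‖ := by rw [add_sub_cancel_right]
        _ ≤ _ := norm_sub_le _ _
    rw [pow_one]
    nlinarith [norm_nonneg a, norm_nonneg (ι u + a),
      mul_nonneg (norm_nonneg a) (norm_nonneg (ι u + a))]⟩ f
  have hF : ∀ u, F u = f (ι u + a) := fun u => rfl
  refine (F.integrable_pow_mul volume (∑ i, γ i)).mono' ?_ (Eventually.of_forall fun u => ?_)
  · simp only [← hF]
    refine (F.continuous.mul ?_).aestronglyMeasurable
    exact Complex.continuous_ofReal.comp (by fun_prop)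
  · rw [norm_mul, Complex.norm_real, Real.norm_eq_abs, Finset.abs_prod, hF, mul_comm]
    gcongr
    rw [← Finset.prod_pow_eq_pow_sum]
    refine Finset.prod_le_prod (fun i _ => abs_nonneg _) fun i _ => ?_
    rw [abs_pow]
    exact pow_le_pow_left₀ (abs_nonneg _) (by simpa using PiLp.norm_apply_le u i) _

/-- On `a + ι ℝᵈ` a linear form is a linear form in the coordinates of `ℝᵈ` plus a constant, so
multiplying by it turns a moment into a combination of moments. -/
theorem momentClass_mul_inner {ι : Rn d →L[ℝ] E} {P : E →L[ℝ] Rn d} (hι : ∀ u, ‖ι u‖ = ‖u‖)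
    (hadj : ∀ u v, inner ℝ (ι u) v = inner ℝ u (P v)) {f : 𝓢(E, ℂ)} (hf : f ∈ momentClass ι P)
    (v : E) : smulLeftCLM ℂ (inner ℝ · v) f ∈ momentClass ι P := by
  intro γ a ha
  have hterm : ∀ u : Rn d, smulLeftCLM ℂ (inner ℝ · v) f (ι u + a) * ((∏ i, u i ^ γ i : ℝ) : ℂ) =
      ∑ k, (((P v) k : ℝ) : ℂ) *
        (f (ι u + a) * ((∏ i, u i ^ (γ + Pi.single k 1 : Fin d → ℕ) i : ℝ) : ℂ)) +
      ((inner ℝ a v : ℝ) : ℂ) * (f (ι u + a) * ((∏ i, u i ^ γ i : ℝ) : ℂ)) := by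
    intro u
    rw [smulLeftCLM_apply_apply (Function.hasTemperateGrowth_inner_left v), inner_add_left, hadj]
    have hk : ∀ k, (∏ i, u i ^ (γ + Pi.single k 1 : Fin d → ℕ) i : ℝ) =
        u k * ∏ i, u i ^ γ i := fun k => by
      simp only [Pi.add_apply, pow_add, Finset.prod_mul_distrib]
      rw [mul_comm]
      congr 1
      rw [Finset.prod_eq_single k (fun i _ hi => by simp [Pi.single_eq_of_ne hi])
        (by simp)]
      simp
    simp only [hk]
    have hin : (inner ℝ u (P v) : ℝ) = ∑ k, (P v) k * u k := by
      rw [PiLp.inner_apply]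
      exact Finset.sum_congr rfl fun k _ => by simp
    rw [hin, Complex.real_smul]
    push_cast
    rw [add_mul, add_mul, Finset.sum_mul, Finset.sum_mul]
    congr 1
    · exact Finset.sum_congr rfl fun k _ => by ring
    · ring
  simp only [hterm]
  rw [integral_add
    (integrable_finsetSum _ fun k _ => (integrable_slice_mul_monomial hι a f _).const_mul _)
    ((integrable_slice_mul_monomial hι a f _).const_mul _),
    integral_finsetSum _ fun k _ => (integrable_slice_mul_monomial hι a f _).const_mul _]
  simp only [integral_const_mul, hf _ a ha, mul_zero, Finset.sum_const_zero, add_zero]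

end VanishingMoments

/-! ### Convergence in the Schwartz space -/

section Product

variable {n m : ℕ}

/-- The inclusion `x₁ ↦ (x₁, 0)`. -/
noncomputable def inclFst : Rn n →L[ℝ] RnRm n m :=
  ((WithLp.prodContinuousLinearEquiv 2 ℝ (Rn n) (Rn m)).symm : Rn n × Rn m →L[ℝ] RnRm n m) ∘L
    ContinuousLinearMap.inl ℝ _ _

/-- The inclusion `x₂ ↦ (0, x₂)`. -/
noncomputable def inclSnd : Rn m →L[ℝ] RnRm n m :=
  ((WithLp.prodContinuousLinearEquiv 2 ℝ (Rn n) (Rn m)).symm : Rn n × Rn m →L[ℝ] RnRm n m) ∘L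
    ContinuousLinearMap.inr ℝ _ _

theorem inclFst_apply (x : Rn n) : (inclFst x : RnRm n m) = WithLp.toLp 2 (x, 0) := rfl

theorem inclSnd_apply (x : Rn m) : (inclSnd x : RnRm n m) = WithLp.toLp 2 (0, x) := rfl

theorem integrable_RnRm {f : RnRm n m → ℂ} (hf : Integrable f) :
    Integrable (fun p : Rn n × Rn m => f (WithLp.toLp 2 p)) (volume.prod volume) :=
  ((WithLp.volume_preserving_toLp (Rn n) (Rn m)).integrable_comp_emb
    (WithLp.prodContinuousLinearEquiv 2 ℝ (Rn n) (Rn m)).symm.toHomeomorph.measurableEmbedding).2 hf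

theorem integrable_fourier_integrand (f : 𝓢(RnRm n m, ℂ)) (ξ : RnRm n m) :
    Integrable fun x : RnRm n m => Real.fourierChar (-inner ℝ x ξ) • f x :=
  (Real.fourierIntegral_convergent_iff ξ).2 f.integrable

/-- By Fubini's theorem `f̂ (0, ξ₂)` is an iterated integral of the slices `f (·, x₂)`, whose
moments of order zero vanish. -/
theorem MemSInfty.flatOn_fst {f : 𝓢(RnRm n m, ℂ)} (hf : MemSInfty f) :
    FlatOn (WithLp.fstL 2 ℝ (Rn n) (Rn m)) (𝓕 f) := by
  have hadd : ∀ (u : Rn n) (a : RnRm n m), a.fst = 0 →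
      inclFst u + a = WithLp.toLp 2 (u, a.snd) := fun u a ha => by
    refine (WithLp.ofLp_injective 2) (Prod.ext ?_ ?_)
    · change u + a.fst = u
      rw [ha, add_zero]
    · change 0 + a.snd = a.snd
      rw [zero_add]
  refine flatOn_fourier (W := momentClass inclFst (WithLp.fstL 2 ℝ (Rn n) (Rn m)))
    (fun f hf v => momentClass_mul_inner (fun u => ?_) (fun u v => ?_) hf v) (fun f hf ξ hξ => ?_)
    (fun γ a ha => ?_)
  · rw [inclFst_apply, WithLp.prod_norm_eq_of_L2]
    simp
  · rw [inclFst_apply, WithLp.prod_inner_apply]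
    simp
  · have hξ' : ξ.fst = 0 := hξ
    rw [fourier_coe, Real.fourier_eq, integral_RnRm]
    change ∫ p, _ ∂(volume.prod volume) = _
    rw [integral_prod_symm _ (integrable_RnRm (integrable_fourier_integrand f ξ))]
    refine integral_eq_zero_of_ae (Eventually.of_forall fun x₂ => ?_)
    have h := hf 0 (WithLp.toLp 2 (0, x₂)) rfl
    simp only [Pi.zero_apply, pow_zero, Finset.prod_const_one, Complex.ofReal_one, mul_one] at h
    have hint : ∀ x₁ : Rn n, Real.fourierChar (-inner ℝ (WithLp.toLp 2 (x₁, x₂)) ξ) •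
        f (WithLp.toLp 2 (x₁, x₂)) = (Real.fourierChar (-inner ℝ x₂ ξ.snd) : ℂ) *
          f (inclFst x₁ + WithLp.toLp 2 (0, x₂)) := fun x₁ => by
      rw [hadd _ _ rfl, WithLp.prod_inner_apply]
      change Real.fourierChar (-(inner ℝ x₁ ξ.fst + inner ℝ x₂ ξ.snd)) • _ = _
      rw [hξ', inner_zero_right, zero_add]
      rfl
    simp only [hint]
    rw [integral_const_mul, h, mul_zero]
    rfl
  · simp only [hadd _ a ha]
    exact (hf (∑ i, γ i) 0).1 γ le_rfl a.snd

theorem MemSInfty.flatOn_snd {f : 𝓢(RnRm n m, ℂ)} (hf : MemSInfty f) :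
    FlatOn (WithLp.sndL 2 ℝ (Rn n) (Rn m)) (𝓕 f) := by
  have hadd : ∀ (u : Rn m) (a : RnRm n m), a.snd = 0 →
      inclSnd u + a = WithLp.toLp 2 (a.fst, u) := fun u a ha => by
    refine (WithLp.ofLp_injective 2) (Prod.ext ?_ ?_)
    · change 0 + a.fst = a.fst
      rw [zero_add]
    · change u + a.snd = u
      rw [ha, add_zero]
  refine flatOn_fourier (W := momentClass inclSnd (WithLp.sndL 2 ℝ (Rn n) (Rn m)))
    (fun f hf v => momentClass_mul_inner (fun u => ?_) (fun u v => ?_) hf v) (fun f hf ξ hξ => ?_)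
    (fun γ a ha => ?_)
  · rw [inclSnd_apply, WithLp.prod_norm_eq_of_L2]
    simp
  · rw [inclSnd_apply, WithLp.prod_inner_apply]
    simp
  · have hξ' : ξ.snd = 0 := hξ
    rw [fourier_coe, Real.fourier_eq, integral_RnRm]
    change ∫ p, _ ∂(volume.prod volume) = _
    rw [integral_prod _ (integrable_RnRm (integrable_fourier_integrand f ξ))]
    refine integral_eq_zero_of_ae (Eventually.of_forall fun x₁ => ?_)
    have h := hf 0 (WithLp.toLp 2 (x₁, 0)) rfl
    simp only [Pi.zero_apply, pow_zero, Finset.prod_const_one, Complex.ofReal_one, mul_one] at h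
    have hint : ∀ x₂ : Rn m, Real.fourierChar (-inner ℝ (WithLp.toLp 2 (x₁, x₂)) ξ) •
        f (WithLp.toLp 2 (x₁, x₂)) = (Real.fourierChar (-inner ℝ x₁ ξ.fst) : ℂ) *
          f (inclSnd x₂ + WithLp.toLp 2 (x₁, 0)) := fun x₂ => by
      rw [hadd _ _ rfl, WithLp.prod_inner_apply]
      change Real.fourierChar (-(inner ℝ x₁ ξ.fst + inner ℝ x₂ ξ.snd)) • _ = _
      rw [hξ', inner_zero_right, add_zero]
      rfl
    simp only [hint]
    rw [integral_const_mul, h, mul_zero]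
    rfl
  · simp only [hadd _ a ha]
    exact (hf 0 (∑ i, γ i)).2 γ le_rfl a.fst

theorem summable_pow_natAbs {ρ : ℝ} (h0 : 0 < ρ) (h1 : ρ < 1) :
    Summable fun j : ℤ => ρ ^ j.natAbs := by
  refine Summable.of_nat_of_neg ?_ ?_ <;>
    simpa using summable_geometric_of_lt_one h0.le h1

/-- Multiplication of a function on `ℝⁿ × ℝᵐ` by `g (T ^ j x₁)`. -/
noncomputable abbrev mulFst (g : Rn n → ℂ) (T : Rn n ≃L[ℝ] Rn n) (j : ℤ) :
    𝓢(RnRm n m, ℂ) →L[ℂ] 𝓢(RnRm n m, ℂ) :=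
  mulComp g (((T ^ j : Rn n ≃L[ℝ] Rn n) : Rn n →L[ℝ] Rn n) ∘L WithLp.fstL 2 ℝ (Rn n) (Rn m))

/-- Multiplication of a function on `ℝⁿ × ℝᵐ` by `g (T ^ j x₂)`. -/
noncomputable abbrev mulSnd (g : Rn m → ℂ) (T : Rn m ≃L[ℝ] Rn m) (j : ℤ) :
    𝓢(RnRm n m, ℂ) →L[ℂ] 𝓢(RnRm n m, ℂ) :=
  mulComp g (((T ^ j : Rn m ≃L[ℝ] Rn m) : Rn m →L[ℝ] Rn m) ∘L WithLp.sndL 2 ℝ (Rn n) (Rn m))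

variable {T₁ : Rn n ≃L[ℝ] Rn n} {T₂ : Rn m ≃L[ℝ] Rn m} {g₁ : Rn n → ℂ} {g₂ : Rn m → ℂ}
  {C₁ ρ₁ δ₁ b₁ C₂ ρ₂ δ₂ b₂ : ℝ}

theorem hasSum_mul_prod {u v : ℤ → ℂ} (hu : HasSum u 1) (hv : HasSum v 1) :
    HasSum (fun j : ℤ × ℤ => u j.1 * v j.2) 1 := by
  have h := hu.mul hv (summable_mul_of_summable_norm hu.summable.norm hv.summable.norm)
  rwa [one_mul] at h

theorem IsAnnularResolution.hasSum_prod
    (h₁ : IsAnnularResolution T₁ g₁ C₁ ρ₁ δ₁ b₁)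
    (h₂ : IsAnnularResolution T₂ g₂ C₂ ρ₂ δ₂ b₂) {x : Rn n} {y : Rn m} (hx : x ≠ 0) (hy : y ≠ 0) :
    HasSum (fun j : ℤ × ℤ => g₁ ((T₁ ^ j.1) x) * g₂ ((T₂ ^ j.2) y)) 1 :=
  hasSum_mul_prod (u := fun j : ℤ => g₁ ((T₁ ^ j) x)) (v := fun j : ℤ => g₂ ((T₂ ^ j) y))
    (h₁.hasSum x hx) (h₂.hasSum y hy)

/-- For `F` flat on both coordinate subspaces, the pieces of `F` cut out by the two-parameter family
of annular multipliers sum to `F` unconditionally in the Schwartz space. -/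
theorem IsAnnularResolution.hasSum_mulFst_mulSnd
    (h₁ : IsAnnularResolution T₁ g₁ C₁ ρ₁ δ₁ b₁) (h₂ : IsAnnularResolution T₂ g₂ C₂ ρ₂ δ₂ b₂)
    {F : 𝓢(RnRm n m, ℂ)} (hF₁ : FlatOn (WithLp.fstL 2 ℝ (Rn n) (Rn m)) F)
    (hF₂ : FlatOn (WithLp.sndL 2 ℝ (Rn n) (Rn m)) F) :
    HasSum (fun j : ℤ × ℤ => mulFst g₁ T₁ j.1 (mulSnd g₂ T₂ j.2 F)) F := by
  have hρ₁ := h₁.expands.rate_pos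
  have hρ₂ := h₂.expands.rate_pos
  refine hasSum_schwartz (fun k l => ?_) fun x => ?_
  · obtain ⟨K₁, k', l', hK₁, hb₁⟩ := h₁.expands.seminorm_mulComp_zpow_le
      (isComplProj_fst (n := n) (m := m)) h₁.boundedDerivs h₁.inner_pos h₁.outer_nonneg
      h₁.norm_mem k l
    obtain ⟨K₂, k'', l'', hK₂, hb₂⟩ := h₂.expands.supSeminorm_mulComp_zpow_le
      (isComplProj_snd (n := n) (m := m)) h₂.boundedDerivs h₂.inner_pos h₂.outer_nonneg
      h₂.norm_mem k' l'
    have hsum : Summable fun j : ℤ × ℤ => ρ₁ ^ j.1.natAbs * ρ₂ ^ j.2.natAbs :=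
      (summable_pow_natAbs hρ₁ h₁.expands.rate_lt_one).mul_of_nonneg
        (summable_pow_natAbs hρ₂ h₂.expands.rate_lt_one)
        (fun j => by positivity) (fun j => by positivity)
    refine Summable.of_nonneg_of_le (fun j => apply_nonneg _ _) (fun j => ?_)
      (hsum.mul_left (K₁ * K₂ * supSeminorm k'' l'' F))
    refine (hb₁ j.1 _ (hF₁.mulComp h₂.boundedDerivs _)).trans ?_
    calc K₁ * ρ₁ ^ j.1.natAbs * supSeminorm k' l' (mulSnd g₂ T₂ j.2 F)
        ≤ K₁ * ρ₁ ^ j.1.natAbs * (K₂ * ρ₂ ^ j.2.natAbs * supSeminorm k'' l'' F) := by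
          gcongr
          exact hb₂ j.2 F hF₂
      _ = _ := by ring
  · have hval : ∀ j : ℤ × ℤ, mulFst g₁ T₁ j.1 (mulSnd g₂ T₂ j.2 F) x =
        g₁ ((T₁ ^ j.1) x.fst) * g₂ ((T₂ ^ j.2) x.snd) * F x := fun j => by
      rw [mulComp_apply h₁.boundedDerivs, mulComp_apply h₂.boundedDerivs, ← mul_assoc]
      rfl
    simp only [hval]
    have hzero : ∀ {W : Type} [NormedAddCommGroup W] [NormedSpace ℝ W] {P : RnRm n m →L[ℝ] W},
        FlatOn P F → P x = 0 → F x = 0 := fun hP hx => by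
      have h := hP 0 x hx
      rwa [← norm_eq_zero, norm_iteratedFDeriv_zero, norm_eq_zero] at h
    -- on the coordinate subspaces the multipliers do not sum to `1`, but `F` vanishes there
    by_cases hx₁ : x.fst = 0
    · simp only [hzero hF₁ hx₁, mul_zero]
      exact hasSum_zero
    by_cases hx₂ : x.snd = 0
    · simp only [hzero hF₂ hx₂, mul_zero]
      exact hasSum_zero
    simpa using (h₁.hasSum_prod h₂ hx₁ hx₂).mul_right (F x)

theorem fourier_convS_dilate_dilate (A₁ : Dilation n) (A₂ : Dilation m) (j₁ j₂ : ℤ)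
    (θ₁ ψ₁ : 𝓢(Rn n, ℂ)) (θ₂ ψ₂ : 𝓢(Rn m, ℂ)) (ξ : RnRm n m) :
    𝓕 (convS (dilate A₁ A₂ j₁ j₂ (tensor ψ₁ ψ₂)) (dilate A₁ A₂ j₁ j₂ (tensor θ₁ θ₂))) ξ =
      (𝓕 ψ₁ ((A₁.transpose.equiv ^ j₁) ξ.fst) * 𝓕 θ₁ ((A₁.transpose.equiv ^ j₁) ξ.fst)) *
      (𝓕 ψ₂ ((A₂.transpose.equiv ^ j₂) ξ.snd) * 𝓕 θ₂ ((A₂.transpose.equiv ^ j₂) ξ.snd)) := by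
  rw [fourier_convS, dilate_tensor, dilate_tensor, fourier_tensor, fourier_tensor, tensor_apply,
    tensor_apply, fourier_dilateOne, fourier_dilateOne, fourier_dilateOne, fourier_dilateOne]
  exact mul_mul_mul_comm _ _ _ _

theorem hasSum_convS_of_memSInfty {A₁ : Dilation n} {A₂ : Dilation m}
    {θ₁ ψ₁ : 𝓢(Rn n, ℂ)} {θ₂ ψ₂ : 𝓢(Rn m, ℂ)}
    (h₁ : IsAnnularResolution A₁.transpose.equiv (fun ξ => 𝓕 ψ₁ ξ * 𝓕 θ₁ ξ) C₁ ρ₁ δ₁ b₁)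
    (h₂ : IsAnnularResolution A₂.transpose.equiv (fun ξ => 𝓕 ψ₂ ξ * 𝓕 θ₂ ξ) C₂ ρ₂ δ₂ b₂)
    {f : 𝓢(RnRm n m, ℂ)} (hf : MemSInfty f) :
    HasSum (fun j : ℤ × ℤ => convS (convS f (dilate A₁ A₂ j.1 j.2 (tensor ψ₁ ψ₂)))
      (dilate A₁ A₂ j.1 j.2 (tensor θ₁ θ₂))) f := by
  have h := (h₁.hasSum_mulFst_mulSnd h₂ hf.flatOn_fst hf.flatOn_snd).mapL
    (fourierInvCLM ℂ 𝓢(RnRm n m, ℂ))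
  rw [fourierInvCLM_apply, FourierTransform.fourierInv_fourier_eq] at h
  convert! h using 2 with j
  refine fourier_injective fun ξ => ?_
  rw [fourierInvCLM_apply, FourierTransform.fourier_fourierInv_eq, convS_assoc, fourier_convS,
    fourier_convS_dilate_dilate, mulComp_apply h₁.boundedDerivs, mulComp_apply h₂.boundedDerivs]
  rw [mul_comm, mul_assoc]
  rfl

end Product

/-! ### Convergence in the space of square integrable functions -/

section ProductSquareIntegrable

variable {n m : ℕ}

/-- This fails for `n = 0`, where the subspace `x₁ = 0` is the whole space. -/
theorem ae_fst_ne_zero (hn : 0 < n) : ∀ᵐ x : RnRm n m, x.fst ≠ 0 := by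
  have h := Measure.addHaar_submodule (volume : Measure (RnRm n m))
    (LinearMap.ker (WithLp.fstL 2 ℝ (Rn n) (Rn m)).toLinearMap) fun htop => by
      have h1 : (inclFst (EuclideanSpace.single ⟨0, hn⟩ 1) : RnRm n m) ∈
          LinearMap.ker (WithLp.fstL 2 ℝ (Rn n) (Rn m)).toLinearMap := by rw [htop]; trivial
      have h2 : (EuclideanSpace.single ⟨0, hn⟩ 1 : Rn n) = 0 := h1
      simpa using congrArg (fun v : Rn n => v ⟨0, hn⟩) h2
  refine measure_mono_null (fun x hx => ?_) h
  exact not_not.1 hx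

theorem ae_snd_ne_zero (hm : 0 < m) : ∀ᵐ x : RnRm n m, x.snd ≠ 0 := by
  have h := Measure.addHaar_submodule (volume : Measure (RnRm n m))
    (LinearMap.ker (WithLp.sndL 2 ℝ (Rn n) (Rn m)).toLinearMap) fun htop => by
      have h1 : (inclSnd (EuclideanSpace.single ⟨0, hm⟩ 1) : RnRm n m) ∈
          LinearMap.ker (WithLp.sndL 2 ℝ (Rn n) (Rn m)).toLinearMap := by rw [htop]; trivial
      have h2 : (EuclideanSpace.single ⟨0, hm⟩ 1 : Rn m) = 0 := h1
      simpa using congrArg (fun v : Rn m => v ⟨0, hm⟩) h2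
  refine measure_mono_null (fun x hx => ?_) h
  exact not_not.1 hx

variable {T₁ : Rn n ≃L[ℝ] Rn n} {T₂ : Rn m ≃L[ℝ] Rn m} {g₁ : Rn n → ℂ} {g₂ : Rn m → ℂ}
  {C₁ ρ₁ δ₁ b₁ C₂ ρ₂ δ₂ b₂ : ℝ}

/-- A finite set of pairs of indices is contained in a rectangle, over which the sum of absolute
values factors. -/
theorem IsAnnularResolution.exists_norm_sum_prod_le
    (h₁ : IsAnnularResolution T₁ g₁ C₁ ρ₁ δ₁ b₁) (h₂ : IsAnnularResolution T₂ g₂ C₂ ρ₂ δ₂ b₂) :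
    ∃ M : ℝ, ∀ (S : Finset (ℤ × ℤ)) (x : Rn n) (y : Rn m),
      ‖∑ j ∈ S, g₁ ((T₁ ^ j.1) x) * g₂ ((T₂ ^ j.2) y)‖ ≤ M := by
  obtain ⟨M₁, hM₁, hs₁⟩ := h₁.exists_sum_norm_le
  obtain ⟨M₂, hM₂, hs₂⟩ := h₂.exists_sum_norm_le
  refine ⟨M₁ * M₂, fun S x y => ?_⟩
  calc ‖∑ j ∈ S, g₁ ((T₁ ^ j.1) x) * g₂ ((T₂ ^ j.2) y)‖
      ≤ ∑ j ∈ S, ‖g₁ ((T₁ ^ j.1) x)‖ * ‖g₂ ((T₂ ^ j.2) y)‖ :=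
        norm_sum_le_of_le _ fun j _ => (norm_mul _ _).le
    _ ≤ ∑ j ∈ S.image Prod.fst ×ˢ S.image Prod.snd,
          ‖g₁ ((T₁ ^ j.1) x)‖ * ‖g₂ ((T₂ ^ j.2) y)‖ :=
        Finset.sum_le_sum_of_subset_of_nonneg (Finset.subset_product) fun j _ _ => by positivity
    _ = (∑ i ∈ S.image Prod.fst, ‖g₁ ((T₁ ^ i) x)‖) *
          ∑ j ∈ S.image Prod.snd, ‖g₂ ((T₂ ^ j) y)‖ := by
        rw [Finset.sum_mul_sum, Finset.sum_product]
    _ ≤ M₁ * M₂ := by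
        gcongr
        · exact hs₁ x _
        · exact hs₂ y _

theorem tendsto_convF_of_memLp (hn : 0 < n) (hm : 0 < m) {A₁ : Dilation n} {A₂ : Dilation m}
    {θ₁ ψ₁ : 𝓢(Rn n, ℂ)} {θ₂ ψ₂ : 𝓢(Rn m, ℂ)}
    (h₁ : IsAnnularResolution A₁.transpose.equiv (fun ξ => 𝓕 ψ₁ ξ * 𝓕 θ₁ ξ) C₁ ρ₁ δ₁ b₁)
    (h₂ : IsAnnularResolution A₂.transpose.equiv (fun ξ => 𝓕 ψ₂ ξ * 𝓕 θ₂ ξ) C₂ ρ₂ δ₂ b₂)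
    {f : RnRm n m → ℂ} (hf : MemLp f 2 volume) :
    Tendsto (fun S : Finset (ℤ × ℤ) => eLpNorm (fun x => f x - ∑ j ∈ S,
      convF (convF f (dilate A₁ A₂ j.1 j.2 (tensor ψ₁ ψ₂)))
        (dilate A₁ A₂ j.1 j.2 (tensor θ₁ θ₂)) x) 2 volume) atTop (𝓝 0) := by
  set K : ℤ × ℤ → 𝓢(RnRm n m, ℂ) := fun j =>
    convS (dilate A₁ A₂ j.1 j.2 (tensor ψ₁ ψ₂)) (dilate A₁ A₂ j.1 j.2 (tensor θ₁ θ₂))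
  have hfourier : ∀ (S : Finset (ℤ × ℤ)) ξ, 𝓕 (∑ j ∈ S, K j) ξ = ∑ j ∈ S,
      (𝓕 ψ₁ ((A₁.transpose.equiv ^ j.1) ξ.fst) * 𝓕 θ₁ ((A₁.transpose.equiv ^ j.1) ξ.fst)) *
      (𝓕 ψ₂ ((A₂.transpose.equiv ^ j.2) ξ.snd) * 𝓕 θ₂ ((A₂.transpose.equiv ^ j.2) ξ.snd)) := by
    intro S ξ
    rw [FourierTransform.fourier_sum, sum_apply]
    exact Finset.sum_congr rfl fun j _ => fourier_convS_dilate_dilate _ _ _ _ _ _ _ _ _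
  obtain ⟨M, hM⟩ := h₁.exists_norm_sum_prod_le h₂
  have h := tendsto_eLpNorm_sub_convFun (l := atTop) (K := fun S : Finset (ℤ × ℤ) => ∑ j ∈ S, K j)
    (M := M) (fun S ξ => by rw [hfourier]; exact hM S _ _) (by
      filter_upwards [ae_fst_ne_zero hn, ae_snd_ne_zero hm] with ξ hξ₁ hξ₂
      simp only [hfourier]
      exact h₁.hasSum_prod h₂ hξ₁ hξ₂) hf
  convert! h using 3 with S
  ext x
  rw [Pi.sub_apply, ← sum_convFun hf]
  congr 1
  exact Finset.sum_congr rfl fun j _ => congrFun (convFun_convFun hf _ _) x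

end ProductSquareIntegrable

/-! ### Approximate identities on the Schwartz space -/

section ApproximateIdentity

theorem le_norm_of_mem_tsupport_one_sub {V : Type*} [NormedAddCommGroup V] {φ : V → ℂ}
    {ε : ℝ} (hφ : ∀ v, ‖v‖ < ε → φ v = 1) {v : V}
    (hv : v ∈ tsupport fun v => 1 - φ v) : ε ≤ ‖v‖ := by
  have hcl : IsClosed {v : V | ε ≤ ‖v‖} := isClosed_le continuous_const continuous_norm
  refine closure_minimal (fun w hw => ?_) hcl hv
  by_contra hlt
  exact hw (by simp only [hφ w (not_le.1 hlt), sub_self])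

variable {E V : Type*} [NormedAddCommGroup E] [NormedSpace ℝ E]
  [NormedAddCommGroup V] [NormedSpace ℝ V] {ι : Type*} {l : Filter ι}

/-- Multiplication by `g ∘ T i`, with `g` vanishing near the origin and `T i` tending to zero, tends
to zero uniformly on bounded families of Schwartz functions. -/
theorem tendsto_mulComp_of_away {g : V → ℂ} (hg : BoundedDerivs g) {δ : ℝ} (hδ : 0 < δ)
    (hsupp : ∀ v ∈ tsupport g, δ ≤ ‖v‖) {T : ι → E →L[ℝ] V}
    (hT : Tendsto (fun i => ‖T i‖) l (𝓝 0)) {F : ι → 𝓢(E, ℂ)}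
    (hF : ∀ k m, ∃ B : ℝ, ∀ᶠ i in l, supSeminorm k m (F i) ≤ B) :
    Tendsto (fun i => mulComp g (T i) (F i)) l (𝓝 0) := by
  refine ((schwartz_withSeminorms ℂ E ℂ).tendsto_nhds _ _).2 fun ⟨k, m⟩ ε hε => ?_
  obtain ⟨K, hK, hbound⟩ := seminorm_mulComp_le_of_away (E := E) hg hδ hsupp k m 1
  obtain ⟨B, hB⟩ := hF (k + 1) m
  have hlim : Tendsto (fun i => K * ‖T i‖ * B) l (𝓝 0) := by
    simpa using (hT.const_mul K).mul_const B
  filter_upwards [hB, hlim.eventually (gt_mem_nhds hε), hT.eventually (gt_mem_nhds one_pos)]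
    with i hi hi' hi''
  rw [sub_zero, schwartzSeminormFamily_apply]
  refine ((hbound (T i) hi''.le (F i)).trans ?_).trans_lt hi'
  gcongr

/-- The multipliers `φ₁ (T₁ x) φ₂ (T₂ x)`, with `φ₁`, `φ₂` equal to `1` near the origin, tend to the
identity on the Schwartz space as `T₁` and `T₂` tend to zero. -/
theorem tendsto_mulComp_mulComp {W : Type*} [NormedAddCommGroup W] [NormedSpace ℝ W]
    {φ₁ : V → ℂ} {φ₂ : W → ℂ} (h₁ : BoundedDerivs φ₁) (h₂ : BoundedDerivs φ₂) {ε₁ ε₂ : ℝ}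
    (hε₁ : 0 < ε₁) (hε₂ : 0 < ε₂) (hone₁ : ∀ v, ‖v‖ < ε₁ → φ₁ v = 1)
    (hone₂ : ∀ v, ‖v‖ < ε₂ → φ₂ v = 1) {T₁ : ι → E →L[ℝ] V} {T₂ : ι → E →L[ℝ] W}
    (hT₁ : Tendsto (fun i => ‖T₁ i‖) l (𝓝 0)) (hT₂ : Tendsto (fun i => ‖T₂ i‖) l (𝓝 0))
    (F : 𝓢(E, ℂ)) :
    Tendsto (fun i => mulComp φ₁ (T₁ i) (mulComp φ₂ (T₂ i) F)) l (𝓝 F) := by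
  -- `φ₁ φ₂ = 1 - (1 - φ₁) - (1 - φ₂) + (1 - φ₁) (1 - φ₂)`, and `1 - φᵢ` vanishes near the origin
  have lim₁ := tendsto_mulComp_of_away h₁.one_sub hε₁
    (fun v hv => le_norm_of_mem_tsupport_one_sub hone₁ hv) hT₁ (F := fun _ => F)
    fun k m => ⟨_, Eventually.of_forall fun _ => le_rfl⟩
  have lim₂ := tendsto_mulComp_of_away h₂.one_sub hε₂
    (fun v hv => le_norm_of_mem_tsupport_one_sub hone₂ hv) hT₂ (F := fun _ => F)
    fun k m => ⟨_, Eventually.of_forall fun _ => le_rfl⟩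
  have lim₁₂ := tendsto_mulComp_of_away h₁.one_sub hε₁
    (fun v hv => le_norm_of_mem_tsupport_one_sub hone₁ hv) hT₁
    (F := fun i => mulComp (fun v => 1 - φ₂ v) (T₂ i) F) fun k m => by
      refine ⟨1, ?_⟩
      have h := ((schwartz_withSeminorms ℂ E ℂ).tendsto_nhds' _ _).1 lim₂ (Finset.Iic (k, m)) 1
        one_pos
      filter_upwards [h] with i hi
      rw [sub_zero] at hi
      exact hi.le
  have hall := ((tendsto_const_nhds (x := F)).sub ((lim₁.add lim₂).sub lim₁₂))
  rw [add_zero, sub_zero, sub_zero] at hall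
  refine hall.congr fun i => ?_
  ext x
  simp only [sub_apply, add_apply, mulComp_apply h₁, mulComp_apply h₂, mulComp_apply h₁.one_sub,
    mulComp_apply h₂.one_sub]
  ring

theorem Expands.tendsto_norm_zpow {T : V ≃L[ℝ] V} {C ρ : ℝ} (hT : Expands T C ρ) :
    Tendsto (fun j : ℤ => ‖((T ^ j : V ≃L[ℝ] V) : V →L[ℝ] V)‖) atBot (𝓝 0) := by
  have h1 : Tendsto (fun j : ℤ => C * ρ ^ j.natAbs) atBot (𝓝 0) := by
    have h := ((summable_pow_natAbs hT.rate_pos hT.rate_lt_one).tendsto_cofinite_zero).const_mul C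
    rw [mul_zero] at h
    exact h.mono_left atBot_le_cofinite
  refine squeeze_zero' (Eventually.of_forall fun j => norm_nonneg _) ?_ h1
  filter_upwards [eventually_le_atBot 0] with j hj
  obtain ⟨n, rfl⟩ : ∃ n : ℕ, j = -n := ⟨(-j).toNat, by lia⟩
  simpa using hT.norm_zpow_neg_le n

end ApproximateIdentity

/-! ### Convergence in the space of tempered distributions -/

section Distributions

variable {n m : ℕ}

theorem fourier_reflect (φ : 𝓢(RnRm n m, ℂ)) (ξ : RnRm n m) : 𝓕 (reflect φ) ξ = 𝓕 φ (-ξ) := by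
  rw [fourier_coe, fourier_coe]
  exact Real.fourier_comp_linearIsometry (LinearIsometryEquiv.neg ℝ) φ ξ

theorem reflect_convS (φ χ : 𝓢(RnRm n m, ℂ)) :
    reflect (convS φ χ) = convS (reflect φ) (reflect χ) :=
  fourier_injective fun ξ => by simp only [fourier_convS, fourier_reflect]

theorem convD_convD (f : 𝓢'(RnRm n m, ℂ)) (φ χ : 𝓢(RnRm n m, ℂ)) :
    convD (convD f φ) χ = convD f (convS φ χ) := by
  ext h
  rw [convD_apply, convD_apply, convD_apply, reflect_convS, convS_assoc]

/-- The convolution `f ∗ φ` tested against `h`, as a linear functional of `φ`. -/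
noncomputable def convDLinear (f : 𝓢'(RnRm n m, ℂ)) (h : 𝓢(RnRm n m, ℂ)) :
    𝓢(RnRm n m, ℂ) →ₗ[ℂ] ℂ where
  toFun φ := convD f φ h
  map_add' φ χ := by
    simp only [convD_apply, convS, reflect, map_add, add_apply]
  map_smul' c φ := by
    simp only [convD_apply, convS, reflect, map_smul, smul_apply,
      RingHom.id_apply]

theorem convDLinear_apply (f : 𝓢'(RnRm n m, ℂ)) (h φ : 𝓢(RnRm n m, ℂ)) :
    convDLinear f h φ = convD f φ h := rfl

variable {T₁ : Rn n ≃L[ℝ] Rn n} {T₂ : Rn m ≃L[ℝ] Rn m} {C₁ ρ₁ C₂ ρ₂ : ℝ}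

theorem fourier_dilate_fourierInv (A₁ : Dilation n) (A₂ : Dilation m) (k₁ k₂ : ℤ)
    (φ₁ : 𝓢(Rn n, ℂ)) (φ₂ : 𝓢(Rn m, ℂ)) (ξ : RnRm n m) :
    𝓕 (dilate A₁ A₂ k₁ k₂ (tensor (𝓕⁻ φ₁) (𝓕⁻ φ₂))) ξ =
      φ₁ ((A₁.transpose.equiv ^ k₁) ξ.fst) * φ₂ ((A₂.transpose.equiv ^ k₂) ξ.snd) := by
  rw [dilate_tensor, fourier_tensor, tensor_apply, fourier_dilateOne, fourier_dilateOne,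
    FourierTransform.fourier_fourierInv_eq, FourierTransform.fourier_fourierInv_eq]

/-- If `φ̂₁` and `φ̂₂` are `1` near the origin, then the dilates of `φ₁ ⊗ φ₂` are an approximate
identity for convolution with tempered distributions as both indices tend to `-∞`. -/
theorem tendsto_convD_dilate {A₁ : Dilation n} {A₂ : Dilation m}
    (hT₁ : Expands A₁.transpose.equiv C₁ ρ₁) (hT₂ : Expands A₂.transpose.equiv C₂ ρ₂)
    {φ₁ : 𝓢(Rn n, ℂ)} {φ₂ : 𝓢(Rn m, ℂ)} {ε₁ ε₂ : ℝ} (hε₁ : 0 < ε₁) (hε₂ : 0 < ε₂)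
    (hone₁ : ∀ v, ‖v‖ < ε₁ → φ₁ v = 1) (hone₂ : ∀ v, ‖v‖ < ε₂ → φ₂ v = 1)
    (f : 𝓢'(RnRm n m, ℂ)) :
    Tendsto (fun k : ℤ × ℤ => convD f (dilate A₁ A₂ k.1 k.2 (tensor (𝓕⁻ φ₁) (𝓕⁻ φ₂))))
      (atBot ×ˢ atBot) (𝓝 f) := by
  refine PointwiseConvergenceCLM.tendsto_iff_forall_tendsto.2 fun h => ?_
  simp only [convD_apply]
  refine (f.continuous.tendsto h).comp ?_
  -- the signs come from the reflection in the definition of the convolution of a distribution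
  set S₁ : ℤ × ℤ → RnRm n m →L[ℝ] Rn n := fun k =>
    -(((A₁.transpose.equiv ^ k.1 : Rn n ≃L[ℝ] Rn n) : Rn n →L[ℝ] Rn n) ∘L
      WithLp.fstL 2 ℝ (Rn n) (Rn m))
  set S₂ : ℤ × ℤ → RnRm n m →L[ℝ] Rn m := fun k =>
    -(((A₂.transpose.equiv ^ k.2 : Rn m ≃L[ℝ] Rn m) : Rn m →L[ℝ] Rn m) ∘L
      WithLp.sndL 2 ℝ (Rn n) (Rn m))
  have hlim₁ : Tendsto (fun k => ‖S₁ k‖) (atBot ×ˢ atBot) (𝓝 0) := by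
    refine squeeze_zero (fun k => norm_nonneg _) (fun k => ?_)
      (hT₁.tendsto_norm_zpow.comp tendsto_fst)
    rw [norm_neg]
    exact (ContinuousLinearMap.opNorm_comp_le _ _).trans (mul_le_of_le_one_right (norm_nonneg _)
      (ContinuousLinearMap.opNorm_le_bound _ zero_le_one fun x => by
        simpa using WithLp.norm_fst_le _ x))
  have hlim₂ : Tendsto (fun k => ‖S₂ k‖) (atBot ×ˢ atBot) (𝓝 0) := by
    refine squeeze_zero (fun k => norm_nonneg _) (fun k => ?_)
      (hT₂.tendsto_norm_zpow.comp tendsto_snd)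
    rw [norm_neg]
    exact (ContinuousLinearMap.opNorm_comp_le _ _).trans (mul_le_of_le_one_right (norm_nonneg _)
      (ContinuousLinearMap.opNorm_le_bound _ zero_le_one fun x => by
        simpa using WithLp.norm_snd_le _ x))
  have hb₁ := BoundedDerivs.of_schwartz φ₁
  have hb₂ := BoundedDerivs.of_schwartz φ₂
  have hmul := tendsto_mulComp_mulComp hb₁ hb₂ hε₁ hε₂ hone₁ hone₂ hlim₁ hlim₂ (𝓕 h)
  have hinv := ((fourierInvCLM ℂ 𝓢(RnRm n m, ℂ)).continuous.tendsto _).comp hmul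
  rw [fourierInvCLM_apply, FourierTransform.fourierInv_fourier_eq] at hinv
  refine hinv.congr fun k => fourier_injective fun ξ => ?_
  rw [Function.comp_apply, fourierInvCLM_apply, FourierTransform.fourier_fourierInv_eq,
    mulComp_apply hb₁, mulComp_apply hb₂, fourier_convS, fourier_reflect,
    fourier_dilate_fourierInv, mul_assoc]
  have e₁ : S₁ k ξ = (A₁.transpose.equiv ^ k.1) (-ξ).fst := by
    change -((A₁.transpose.equiv ^ k.1) ξ.fst) = (A₁.transpose.equiv ^ k.1) (-ξ.fst)
    rw [map_neg]
  have e₂ : S₂ k ξ = (A₂.transpose.equiv ^ k.2) (-ξ).snd := by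
    change -((A₂.transpose.equiv ^ k.2) ξ.snd) = (A₂.transpose.equiv ^ k.2) (-ξ.snd)
    rw [map_neg]
  rw [e₁, e₂]

/-- The rectangular partial sums telescope into four convolutions with dilates of the low-pass
kernel, one for each corner of the rectangle. -/
theorem sum_convS_dilate_eq {A₁ : Dilation n} {A₂ : Dilation m}
    {θ₁ ψ₁ φ₁ : 𝓢(Rn n, ℂ)} {θ₂ ψ₂ φ₂ : 𝓢(Rn m, ℂ)}
    (h₁ : ∀ ξ, φ₁ ξ - φ₁ (A₁.transpose.equiv ξ) = 𝓕 ψ₁ ξ * 𝓕 θ₁ ξ)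
    (h₂ : ∀ ξ, φ₂ ξ - φ₂ (A₂.transpose.equiv ξ) = 𝓕 ψ₂ ξ * 𝓕 θ₂ ξ)
    {M₁ N₁ M₂ N₂ : ℤ} (hMN₁ : M₁ ≤ N₁) (hMN₂ : M₂ ≤ N₂) :
    ∑ j₁ ∈ Finset.Icc M₁ N₁, ∑ j₂ ∈ Finset.Icc M₂ N₂,
      convS (dilate A₁ A₂ j₁ j₂ (tensor ψ₁ ψ₂)) (dilate A₁ A₂ j₁ j₂ (tensor θ₁ θ₂)) =
    dilate A₁ A₂ M₁ M₂ (tensor (𝓕⁻ φ₁) (𝓕⁻ φ₂)) +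
      dilate A₁ A₂ (N₁ + 1) (N₂ + 1) (tensor (𝓕⁻ φ₁) (𝓕⁻ φ₂)) +
      -dilate A₁ A₂ (N₁ + 1) M₂ (tensor (𝓕⁻ φ₁) (𝓕⁻ φ₂)) +
      -dilate A₁ A₂ M₁ (N₂ + 1) (tensor (𝓕⁻ φ₁) (𝓕⁻ φ₂)) := by
  refine fourier_injective fun ξ => ?_
  rw [FourierTransform.fourier_sum, sum_apply]
  simp only [FourierTransform.fourier_sum, sum_apply, fourier_convS_dilate_dilate,
    FourierTransform.fourier_add, FourierTransform.fourier_neg, add_apply, neg_apply,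
    fourier_dilate_fourierInv]
  have s₁ := sum_Icc_dilates_eq (g := fun ξ => 𝓕 ψ₁ ξ * 𝓕 θ₁ ξ) h₁ hMN₁ ξ.fst
  have s₂ := sum_Icc_dilates_eq (g := fun ξ => 𝓕 ψ₂ ξ * 𝓕 θ₂ ξ) h₂ hMN₂ ξ.snd
  rw [← Finset.sum_mul_sum, s₁, s₂]
  ring

theorem tendsto_convD_of_vanishes {A₁ : Dilation n} {A₂ : Dilation m}
    {θ₁ ψ₁ : 𝓢(Rn n, ℂ)} {θ₂ ψ₂ : 𝓢(Rn m, ℂ)} {δ₁ b₁ δ₂ b₂ : ℝ}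
    (h₁ : IsAnnularResolution A₁.transpose.equiv (fun ξ => 𝓕 ψ₁ ξ * 𝓕 θ₁ ξ) C₁ ρ₁ δ₁ b₁)
    (h₂ : IsAnnularResolution A₂.transpose.equiv (fun ξ => 𝓕 ψ₂ ξ * 𝓕 θ₂ ξ) C₂ ρ₂ δ₂ b₂)
    {f : 𝓢'(RnRm n m, ℂ)} (hf : VanishesWeaklyAtInfinity A₁ A₂ f) :
    Tendsto (fun N : (ℤ × ℤ) × (ℤ × ℤ) =>
      ∑ j₁ ∈ Finset.Icc N.1.1 N.1.2, ∑ j₂ ∈ Finset.Icc N.2.1 N.2.2,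
        convD (convD f (dilate A₁ A₂ j₁ j₂ (tensor ψ₁ ψ₂))) (dilate A₁ A₂ j₁ j₂ (tensor θ₁ θ₂)))
      ((atBot ×ˢ atTop) ×ˢ (atBot ×ˢ atTop)) (𝓝 f) := by
  obtain ⟨φ₁, hφ₁, ε₁, hε₁, hone₁⟩ := h₁.exists_lowPass
  obtain ⟨φ₂, hφ₂, ε₂, hε₂, hone₂⟩ := h₂.exists_lowPass
  set D : ℤ × ℤ → 𝓢(RnRm n m, ℂ) := fun k => dilate A₁ A₂ k.1 k.2 (tensor (𝓕⁻ φ₁) (𝓕⁻ φ₂))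
  set l : Filter ((ℤ × ℤ) × (ℤ × ℤ)) := (atBot ×ˢ atTop) ×ˢ (atBot ×ˢ atTop)
  have hM₁ : Tendsto (fun N : (ℤ × ℤ) × (ℤ × ℤ) => N.1.1) l atBot := tendsto_fst.comp tendsto_fst
  have hN₁ : Tendsto (fun N : (ℤ × ℤ) × (ℤ × ℤ) => N.1.2) l atTop := tendsto_snd.comp tendsto_fst
  have hM₂ : Tendsto (fun N : (ℤ × ℤ) × (ℤ × ℤ) => N.2.1) l atBot := tendsto_fst.comp tendsto_snd
  have hN₂ : Tendsto (fun N : (ℤ × ℤ) × (ℤ × ℤ) => N.2.2) l atTop := tendsto_snd.comp tendsto_snd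
  have hlow : Tendsto (fun N : (ℤ × ℤ) × (ℤ × ℤ) => convD f (D (N.1.1, N.2.1))) l (𝓝 f) :=
    (tendsto_convD_dilate h₁.expands h₂.expands hε₁ hε₂ hone₁ hone₂ f).comp (hM₁.prodMk hM₂)
  have hvan := hf (𝓕⁻ φ₁) (𝓕⁻ φ₂)
  have hN₁' : Tendsto (fun N : (ℤ × ℤ) × (ℤ × ℤ) => N.1.2 + 1) l atTop :=
    tendsto_atTop_add_const_right _ 1 hN₁
  have hN₂' : Tendsto (fun N : (ℤ × ℤ) × (ℤ × ℤ) => N.2.2 + 1) l atTop :=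
    tendsto_atTop_add_const_right _ 1 hN₂
  have hhh : Tendsto (fun N : (ℤ × ℤ) × (ℤ × ℤ) => convD f (D (N.1.2 + 1, N.2.2 + 1))) l (𝓝 0) :=
    hvan.comp (tendsto_comap_iff.2 (tendsto_atTop_mono (fun N => le_max_left _ _) hN₁'))
  have hhl : Tendsto (fun N : (ℤ × ℤ) × (ℤ × ℤ) => convD f (D (N.1.2 + 1, N.2.1))) l (𝓝 0) :=
    hvan.comp (tendsto_comap_iff.2 (tendsto_atTop_mono (fun N => le_max_left _ _) hN₁'))
  have hlh : Tendsto (fun N : (ℤ × ℤ) × (ℤ × ℤ) => convD f (D (N.1.1, N.2.2 + 1))) l (𝓝 0) :=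
    hvan.comp (tendsto_comap_iff.2 (tendsto_atTop_mono (fun N => le_max_right _ _) hN₂'))
  refine PointwiseConvergenceCLM.tendsto_iff_forall_tendsto.2 fun h => ?_
  have ev := fun {u : (ℤ × ℤ) × (ℤ × ℤ) → 𝓢'(RnRm n m, ℂ)} {u₀ : 𝓢'(RnRm n m, ℂ)}
    (hu : Tendsto u l (𝓝 u₀)) => PointwiseConvergenceCLM.tendsto_iff_forall_tendsto.1 hu h
  have hall := (((ev hlow).add (ev hhh)).add (ev hhl).neg).add (ev hlh).neg
  have hzero : (0 : 𝓢'(RnRm n m, ℂ)) h = 0 := rfl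
  rw [hzero, neg_zero, add_zero, add_zero, add_zero] at hall
  refine hall.congr' ?_
  filter_upwards [hM₁.eventually (eventually_le_atBot 0), hN₁.eventually (eventually_ge_atTop 0),
    hM₂.eventually (eventually_le_atBot 0), hN₂.eventually (eventually_ge_atTop 0)]
    with N a₁ a₂ a₃ a₄
  have hsum : (∑ j₁ ∈ Finset.Icc N.1.1 N.1.2, ∑ j₂ ∈ Finset.Icc N.2.1 N.2.2,
      convD (convD f (dilate A₁ A₂ j₁ j₂ (tensor ψ₁ ψ₂)))
        (dilate A₁ A₂ j₁ j₂ (tensor θ₁ θ₂))) h =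
      ∑ j₁ ∈ Finset.Icc N.1.1 N.1.2, ∑ j₂ ∈ Finset.Icc N.2.1 N.2.2,
        convDLinear f h (convS (dilate A₁ A₂ j₁ j₂ (tensor ψ₁ ψ₂))
          (dilate A₁ A₂ j₁ j₂ (tensor θ₁ θ₂))) := by
    simp only [convD_convD, convDLinear_apply]
    rw [sum_apply]
    exact Finset.sum_congr rfl fun j _ => sum_apply _ _ _
  rw [hsum]
  simp only [← map_sum]
  rw [sum_convS_dilate_eq hφ₁ hφ₂ (a₁.trans a₂) (a₃.trans a₄)]
  simp only [map_add, map_neg]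
  rfl

end Distributions

end AnisoCalderon

open AnisoCalderon in
theorem proposition2p5 {n m : ℕ} (hn : 0 < n) (hm : 0 < m)
    (s₁ s₂ : ℕ) (A₁ : Dilation n) (A₂ : Dilation m)
    (Δ₁ : Set (Rn n)) (Δ₂ : Set (Rn m)) (hΔ₁ : A₁.IsUnitBall Δ₁) (hΔ₂ : A₂.IsUnitBall Δ₂)
    (θ₁ ψ₁ : 𝓢(Rn n, ℂ)) (θ₂ ψ₂ : 𝓢(Rn m, ℂ))
    (h₁ : IsCalderonPair A₁ Δ₁ s₁ θ₁ ψ₁) (h₂ : IsCalderonPair A₂ Δ₂ s₂ θ₂ ψ₂)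
    (θ ψ : 𝓢(RnRm n m, ℂ)) (hθ : θ = tensor θ₁ θ₂) (hψ : ψ = tensor ψ₁ ψ₂) :
    -- convergence in `L²`, unconditionally
    (∀ f : RnRm n m → ℂ, MemLp f 2 volume →
      (∀ j₁ j₂ : ℤ,
        MemLp (convF (convF f (dilate A₁ A₂ j₁ j₂ ψ)) (dilate A₁ A₂ j₁ j₂ θ)) 2 volume) ∧
      Tendsto (fun S : Finset (ℤ × ℤ) =>
        eLpNorm (fun x => f x - ∑ j ∈ S,
          convF (convF f (dilate A₁ A₂ j.1 j.2 ψ)) (dilate A₁ A₂ j.1 j.2 θ) x) 2 volume)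
        atTop (𝓝 0)) ∧
    -- convergence in `𝒮`, unconditionally
    (∀ f : 𝓢(RnRm n m, ℂ), MemSInfty f →
      HasSum (fun j : ℤ × ℤ =>
        convS (convS f (dilate A₁ A₂ j.1 j.2 ψ)) (dilate A₁ A₂ j.1 j.2 θ)) f) ∧
    -- convergence in `𝒮'` of the rectangular partial sums
    (∀ f : 𝓢'(RnRm n m, ℂ), VanishesWeaklyAtInfinity A₁ A₂ f →
      Tendsto (fun N : (ℤ × ℤ) × (ℤ × ℤ) =>
        ∑ j₁ ∈ Finset.Icc N.1.1 N.1.2, ∑ j₂ ∈ Finset.Icc N.2.1 N.2.2,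
          convD (convD f (dilate A₁ A₂ j₁ j₂ ψ)) (dilate A₁ A₂ j₁ j₂ θ))
        ((atBot ×ˢ atTop) ×ˢ (atBot ×ˢ atTop)) (𝓝 f)) := by
  subst hθ hψ
  obtain ⟨C₁, ρ₁, δ₁, b₁, hR₁⟩ := h₁.exists_isAnnularResolution hΔ₁
  obtain ⟨C₂, ρ₂, δ₂, b₂, hR₂⟩ := h₂.exists_isAnnularResolution hΔ₂
  exact ⟨fun f hf => ⟨fun j₁ j₂ => memLp_convFun (memLp_convFun hf _) _,
    tendsto_convF_of_memLp hn hm hR₁ hR₂ hf⟩,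
    fun f hf => hasSum_convS_of_memSInfty hR₁ hR₂ hf,
    fun f hf => tendsto_convD_of_vanishes hR₁ hR₂ hf⟩
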